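/- A structural matrix is a matrix with entries in $\{0,\star\}$. A pair $(\bar A,\bar B)$ with $\bar A\in\{0,\star\}^{n\times n}$, $\bar B\in\{0,\star\}^{n\times p}$ is structurally controllable if there are real matrices $A,B$ of the same sizes, vanishing wherever $\bar A$, respectively $\bar B$, has the entry $0$ (the other entries being arbitrary), such that $\dot x=Ax+Bu$ is controllable. For $\mathcal J\subseteq\{1,\dots,p\}$, $\bar B(\mathcal J)$ denotes the columns of $\bar B$ with index in $\mathcal J$. Let $\mathbb I_N=\mathrm{diag}(\star,\dots,\star)\in\{0,\star\}^{N\times N}$. Consider the following problems. * $\bar{\mathcal L}_1$ (structural unconstrained leader selection, with dedicated inputs): given $\bar W\in\{0,\star\}^{N\times N}$ with all diagonal entries equal to $\star$, find $\mathcal J\subseteq\{1,\dots,N\}$ of minimum cardinality such that $(\bar W,\mathbb I_N(\mathcal J))$ is structurally controllable. * $\bar{\mathcal L}_2$ (structural constrained leader selection): given $\bar W\in\{0,\star\}^{N\times N}$ with all diagonal entries equal to $\star$ and $\bar B\in\{0,\star\}^{N\times L}$, find $\mathcal J\subseteq\{1,\dots,L\}$ of minimum cardinality such that $(\bar W,\bar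 B(\mathcal J))$ is structurally controllable. * Minimum set covering: given a universe $\mathcal U=\{1,\dots,k\}$ and sets $\mathcal S_1,\dots,\mathcal S_p\subseteq\mathcal U$, find $\mathcal J\subseteq\{1,\dots,p\}$ of minimum cardinality such that $\bigcup_{j\in\mathcal J}\mathcal S_j=\mathcal U$. The state digraph of $\bar W$ has vertices $x_1,\dots,x_N$ and an edge $(x_i,x_j)$ whenever $\bar W_{j,i}=\star$. A strongly connected component (SCC) of it is non-top linked if no edge enters it from a vertex of another SCC. **Statement.** Both problems reduce in polynomial time to minimum set covering, in the following way. For each of the two problems there are an algorithm and a polynomial $q$ such that on every instance (put $\bar B=\mathbb I_N$ and $L=N$ for $\bar{\mathcal L}_1$) the algorithm, given $\bar W$ for $\bar{\mathcal L}_1$ and $(\bar W,\bar B)$ for $\bar{\mathcal L}_2$, halts after at most $q(N)$ operations for $\bar{\mathcal L}_1$, and at most $q(N+L)$ operations for $\bar{\mathcal L}_2$, and outputs the set covering instance with universe $\mathcal U=\{1,\dots,k\}$ and sets $$\mathcal S_j=\{i\in\mathcal U:\ \bar B_{r,j}=\star\text{ for some } r \text{ with } x_r\in\mathcal N^i\},\qquad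 j=1,\dots,L,$$ where $\mathcal N^1,\dots,\mathcal N^k$ is an enumeration, without repetition, of all non-top linked SCCs of the state digraph of $\bar W$. Moreover, for every $\mathcal J\subseteq\{1,\dots,L\}$: 1. $(\bar W,\bar B(\mathcal J))$ is structurally controllable if and only if $\bigcup_{j\in\mathcal J}\mathcal S_j=\mathcal U$; 2. $\mathcal J$ is a solution of the leader-selection problem if and only if it is a solution of this minimum set covering problem. Finally, $\bigcup_{j=1}^{L}\mathcal S_j=\mathcal U$ always holds for $\bar{\mathcal L}_1$, and for $\bar{\mathcal L}_2$ it holds if and only if $(\bar W,\bar B)$ is structurally controllable. Here an algorithm is a program of a random access machine with natural-number variables and two-dimensional arrays with indirect addressing, whose elementary instructions (constants, copying, successor, loading, storing, and comparison of two variables) count as one operation each. -/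

import Mathlib

namespace LeaderSelection

/-! ### Structural matrices and structural controllability -/

/-- An `m × n` structural matrix, i.e. an element of `{0,⋆}^{m×n}`: the value `true` stands for
the free parameter `⋆` and the value `false` for the fixed zero `0`. -/
abbrev StructMatrix (m n : Type*) := Matrix m n Bool

/-- `A` is a numerical realization of the structural matrix `M`: it has zeros in the locations
prescribed by `M`, the remaining entries being arbitrary real numbers. -/
def IsRealization {m n : Type*} (M : StructMatrix m n) (A : Matrix m n ℝ) : Prop :=
  ∀ i j, M i j = false → A i j = 0

/-- The linear time-invariant system `x'(t) = A x(t) + B u(t)` is controllable: every state `x₀`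
can be steered to every state `x₁` in some finite time `T > 0` by a (continuous) input `u`. -/
def IsControllable {n p : Type*} [Fintype n] [Fintype p]
    (A : Matrix n n ℝ) (B : Matrix n p ℝ) : Prop :=
  ∀ x₀ x₁ : n → ℝ, ∃ T : ℝ, 0 < T ∧ ∃ (u : ℝ → p → ℝ) (x : ℝ → n → ℝ),
    ContinuousOn u (Set.Icc 0 T) ∧
    (∀ t ∈ Set.Icc (0 : ℝ) T,
      HasDerivWithinAt x (A.mulVec (x t) + B.mulVec (u t)) (Set.Icc 0 T) t) ∧
    x 0 = x₀ ∧ x T = x₁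

/-- The pair `(Ā, B̄)` is structurally controllable: some numerical realization of it is
controllable. -/
def IsStructurallyControllable {n p : Type*} [Fintype n] [Fintype p]
    (Abar : StructMatrix n n) (Bbar : StructMatrix n p) : Prop :=
  ∃ (A : Matrix n n ℝ) (B : Matrix n p ℝ),
    IsRealization Abar A ∧ IsRealization Bbar B ∧ IsControllable A B

/-- `B̄(J)`: the columns of `B̄` with index in `J`. -/
def selectColumns {n p : Type*} (Bbar : StructMatrix n p) (J : Finset p) : StructMatrix n J :=
  Bbar.submatrix id Subtype.val

/-- `𝕀_N = diag(⋆,…,⋆)`, the dedicated input configuration. -/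
def dedicatedInputs (N : ℕ) : StructMatrix (Fin N) (Fin N) :=
  fun i j => decide (i = j)

/-! ### The two leader-selection problems -/

/-- `J` is a solution of the structural constrained leader-selection problem `L̄₂` with dynamics
`W̄` and actuation `B̄`: it is a set of leaders of minimum cardinality among all those for which
`(W̄, B̄(J))` is structurally controllable. -/
def SolvesConstrained {N L : ℕ} (W : StructMatrix (Fin N) (Fin N))
    (Bbar : StructMatrix (Fin N) (Fin L)) (J : Finset (Fin L)) : Prop :=
  IsStructurallyControllable W (selectColumns Bbar J) ∧
  ∀ J' : Finset (Fin L), IsStructurallyControllable W (selectColumns Bbar J') → J.card ≤ J'.card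

/-- `J` is a solution of the structural (unconstrained) leader-selection problem `L̄₁` with
dynamics `W̄`: it is a set of agents of minimum cardinality among all those for which
`(W̄, 𝕀_N(J))` is structurally controllable. -/
def SolvesUnconstrained {N : ℕ} (W : StructMatrix (Fin N) (Fin N)) (J : Finset (Fin N)) : Prop :=
  IsStructurallyControllable W (selectColumns (dedicatedInputs N) J) ∧
  ∀ J' : Finset (Fin N),
    IsStructurallyControllable W (selectColumns (dedicatedInputs N) J') → J.card ≤ J'.card

/-! ### The state digraph and its non-top linked strongly connected components -/

/-- The edge `(x_i, x_j)` of the state digraph `D(Ā)`, present iff `Ā_{j,i} ≠ 0`. -/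
def Edge {n : Type*} (Abar : StructMatrix n n) (i j : n) : Prop :=
  Abar j i = true

/-- There is a directed path (possibly of length zero) from `x_i` to `x_j` in `D(Ā)`. -/
def Reaches {n : Type*} (Abar : StructMatrix n n) : n → n → Prop :=
  Relation.ReflTransGen (Edge Abar)

/-- `C` is the vertex set of a strongly connected component of `D(Ā)`. -/
def IsSCC {n : Type*} (Abar : StructMatrix n n) (C : Set n) : Prop :=
  Maximal (fun S : Set n => S.Nonempty ∧ ∀ u ∈ S, ∀ v ∈ S, Reaches Abar u v) C

/-- `C` is a non-top linked SCC: no edge enters `C` from a vertex of another SCC. -/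
def IsNonTopLinkedSCC {n : Type*} (Abar : StructMatrix n n) (C : Set n) : Prop :=
  IsSCC Abar C ∧ ∀ u ∉ C, ∀ v ∈ C, ¬ Edge Abar u v

/-! ### Minimum set covering -/

/-- The sets `S_j` with `j ∈ J` cover the universe `{1,…,k}`. -/
def IsCover {k p : ℕ} (S : Fin p → Finset (Fin k)) (J : Finset (Fin p)) : Prop :=
  J.biUnion S = Finset.univ

/-- `J` is a solution of the minimum set covering problem with sets `S_1,…,S_p`. -/
def SolvesMinSetCover {k p : ℕ} (S : Fin p → Finset (Fin k)) (J : Finset (Fin p)) : Prop :=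
  IsCover S J ∧ ∀ J' : Finset (Fin p), IsCover S J' → J.card ≤ J'.card

open Classical in
/-- The sets `S_j = {i : ∃ r, B̄_{r,j} = ⋆ and x_r ∈ 𝒩^i}`, where `𝒩^1,…,𝒩^k` are given
sets of states. -/
noncomputable def coverSets {N L k : ℕ} (Bbar : StructMatrix (Fin N) (Fin L))
    (comp : Fin k → Set (Fin N)) (j : Fin L) : Finset (Fin k) :=
  Finset.univ.filter fun i => ∃ r, Bbar r j = true ∧ r ∈ comp i

/-! ### Algorithms and their number of operations

Algorithms are programs with finitely many instructions over natural-number variables and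
two-dimensional arrays of natural numbers with indirect addressing (a random access machine).
The only arithmetic operation is the successor, and every elementary instruction and every
evaluation of a test counts as one operation. -/

/-- The memory: `var x` is the value of the variable `x`, and `arr a i j` the entry `(i,j)` of the
array `a`. -/
structure Memory where
  var : ℕ → ℕ
  arr : ℕ → ℕ → ℕ → ℕ

namespace Memory

/-- The memory after the assignment `x := v`. -/
def setVar (m : Memory) (x v : ℕ) : Memory where
  var := Function.update m.var x v
  arr := m.arr

/-- The memory after the assignment `a[i,j] := v`. -/
def setArr (m : Memory) (a i j v : ℕ) : Memory where
  var := m.var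
  arr := Function.update m.arr a
    (Function.update (m.arr a) i (Function.update (m.arr a i) j v))

end Memory

/-- Tests comparing the values of two variables. -/
inductive Test where
  | eq (x y : ℕ)
  | lt (x y : ℕ)

/-- The test succeeds in memory `m`. -/
def Test.Holds (m : Memory) : Test → Prop
  | .eq x y => m.var x = m.var y
  | .lt x y => m.var x < m.var y

/-- Programs. Numerical parameters are names of variables (`x`, `y`, `i`, `j`), names of
arrays (`a`), or a constant (`c`). -/
inductive Program where
  /-- do nothing -/
  | skip
  /-- `x := c` -/
  | const (x c : ℕ)
  /-- `x := y` -/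
  | copy (x y : ℕ)
  /-- `x := x + 1` -/
  | succ (x : ℕ)
  /-- `x := a[i,j]` -/
  | load (x a i j : ℕ)
  /-- `a[i,j] := x` -/
  | store (a i j x : ℕ)
  /-- execute `P`, then `Q` -/
  | seq (P Q : Program)
  /-- execute `P` if the test succeeds, and `Q` otherwise -/
  | cond (b : Test) (P Q : Program)
  /-- execute `P` as long as the test succeeds -/
  | loop (b : Test) (P : Program)

/-- `Runs P m t m'`: started in memory `m`, the program `P` halts after exactly `t` operations,
leaving the memory `m'`. -/
inductive Runs : Program → Memory → ℕ → Memory → Prop where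
  | skip (m : Memory) : Runs .skip m 1 m
  | const (m : Memory) (x c : ℕ) : Runs (.const x c) m 1 (m.setVar x c)
  | copy (m : Memory) (x y : ℕ) : Runs (.copy x y) m 1 (m.setVar x (m.var y))
  | succ (m : Memory) (x : ℕ) : Runs (.succ x) m 1 (m.setVar x (m.var x + 1))
  | load (m : Memory) (x a i j : ℕ) :
      Runs (.load x a i j) m 1 (m.setVar x (m.arr a (m.var i) (m.var j)))
  | store (m : Memory) (a i j x : ℕ) :
      Runs (.store a i j x) m 1 (m.setArr a (m.var i) (m.var j) (m.var x))
  | seq {P Q : Program} {m m' m'' : Memory} {s t : ℕ} :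
      Runs P m s m' → Runs Q m' t m'' → Runs (.seq P Q) m (s + t) m''
  | cond_pos {b : Test} {P Q : Program} {m m' : Memory} {t : ℕ} :
      b.Holds m → Runs P m t m' → Runs (.cond b P Q) m (t + 1) m'
  | cond_neg {b : Test} {P Q : Program} {m m' : Memory} {t : ℕ} :
      ¬ b.Holds m → Runs Q m t m' → Runs (.cond b P Q) m (t + 1) m'
  | loop_done {b : Test} {P : Program} {m : Memory} :
      ¬ b.Holds m → Runs (.loop b P) m 1 m
  | loop_step {b : Test} {P : Program} {m m' m'' : Memory} {s t : ℕ} :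
      b.Holds m → Runs P m s m' → Runs (.loop b P) m' t m'' →
      Runs (.loop b P) m (s + t + 1) m''

/-- A structural matrix as the content of an array: `1` for `⋆`, and `0` for `0` as well as for
all positions outside of the matrix. -/
def arrayOf {m n : ℕ} (M : StructMatrix (Fin m) (Fin n)) (i j : ℕ) : ℕ :=
  if h : i < m ∧ j < n then (if M ⟨i, h.1⟩ ⟨j, h.2⟩ = true then 1 else 0) else 0

/-- The memory holding an instance `W̄` of `L̄₁`: the number `N` of agents in variable `0`, the
matrix `W̄` in array `0`, and zeros elsewhere. -/
def unconstrainedInput {N : ℕ} (W : StructMatrix (Fin N) (Fin N)) : Memory where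
  var x := if x = 0 then N else 0
  arr a := if a = 0 then arrayOf W else fun _ _ => 0

/-- The memory holding an instance `(W̄, B̄)` of `L̄₂`: the numbers `N` of agents and `L` of
potential leaders in the variables `0` and `1`, the matrices `W̄` and `B̄` in the arrays `0` and
`1`, and zeros elsewhere. -/
def constrainedInput {N L : ℕ} (W : StructMatrix (Fin N) (Fin N))
    (Bbar : StructMatrix (Fin N) (Fin L)) : Memory where
  var x := if x = 0 then N else if x = 1 then L else 0
  arr a := if a = 0 then arrayOf W else if a = 1 then arrayOf Bbar else fun _ _ => 0

/-- The memory `m` holds, as output, the set covering instance with universe `{1,…,k}` and sets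
`S_1,…,S_p`: the size `k` of the universe is in variable `2`, the number `p` of sets in variable
`3`, and the incidence table of the sets in array `2`, one row per set. -/
def HoldsSetCover {k p : ℕ} (m : Memory) (S : Fin p → Finset (Fin k)) : Prop :=
  m.var 2 = k ∧ m.var 3 = p ∧
  ∀ (j : Fin p) (i : Fin k), m.arr 2 j i = if i ∈ S j then 1 else 0

end LeaderSelection

open LeaderSelection

/-! Since every diagonal entry of W̄ is free, structural controllability amounts to every state
being reachable from a state with an input (`isStructurallyControllable_iff`). Necessity: the states
not so reached evolve autonomously, hence never leave 0. Sufficiency: take a spanning forest rooted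
at the inputs, weight 1 on its edges and distinct numbers on the diagonal. No nonzero space of
functionals is then invariant under Aᵀ and killed by Bᵀ (`eq_bot_of_forest`), and this forces
controllability by a Gramian-type duality argument (`isControllable_of_forall_invariant`).

In a finite digraph every vertex lies downstream of some non-top linked SCC, and such an SCC is
closed under predecessors. Reachability from the inputs therefore means that every non-top linked
SCC receives an input, which is the covering condition (`isCover_coverSets_iff`). Both minimization
problems have the same feasible sets, hence the same solutions.

The program computes the reachability relation by Warshall's method and scans for the least vertex
of each non-top linked SCC: a vertex v such that every vertex reaching v is reached back from v and
is not smaller. The SCC of v is exactly its set of predecessors, so the incidence table is read off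
from the closure and B̄. Correctness and operation counts are proved together through `Achieves`;
loops are nested at most three deep, which gives a cubic bound. -/

namespace LeaderSelection

/-! ### Controllability from the absence of invariant subspaces -/

section Controllability

variable {n p : Type*} [Fintype n] [Fintype p]

/-- The flow `exp (t A)` of `x' = A x`. -/
noncomputable def flow (A : Matrix n n ℝ) (t : ℝ) : (n → ℝ) →L[ℝ] (n → ℝ) :=
  NormedSpace.exp (t • LinearMap.toContinuousLinearMap A.mulVecLin)

theorem hasDerivAt_flow (A : Matrix n n ℝ) (t : ℝ) :
    HasDerivAt (flow A) ((LinearMap.toContinuousLinearMap A.mulVecLin) * flow A t) t :=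
  hasDerivAt_exp_smul_const' (𝕂 := ℝ) (𝔸 := (n → ℝ) →L[ℝ] (n → ℝ))
    (LinearMap.toContinuousLinearMap A.mulVecLin) t

theorem hasDerivAt_flow_apply (A : Matrix n n ℝ) {y : ℝ → n → ℝ} {y' : n → ℝ} {t : ℝ}
    (hy : HasDerivAt y y' t) :
    HasDerivAt (fun s => flow A s (y s)) (A.mulVec (flow A t (y t)) + flow A t y') t :=
  (hasDerivAt_flow A t).clm_apply hy

theorem continuous_flow (A : Matrix n n ℝ) : Continuous (flow A) :=
  continuous_iff_continuousAt.2 fun t => (hasDerivAt_flow A t).continuousAt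

@[simp] theorem flow_zero (A : Matrix n n ℝ) : flow A 0 = 1 := by simp [flow]

theorem flow_mul_flow_neg (A : Matrix n n ℝ) (t : ℝ) : flow A t * flow A (-t) = 1 := by
  rw [flow, flow, ← NormedSpace.exp_add_of_commute_of_mem_ball (𝕂 := ℝ)]
  · rw [← add_smul]; simp
  · exact ((Commute.refl _).smul_left _).smul_right _
  all_goals simp [NormedSpace.expSeries_radius_eq_top]

theorem flow_apply_flow_neg (A : Matrix n n ℝ) (t : ℝ) (v : n → ℝ) :
    flow A t (flow A (-t) v) = v :=
  congrArg (fun f : (n → ℝ) →L[ℝ] (n → ℝ) => f v) (flow_mul_flow_neg A t)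

theorem continuous_mulVec_comp {n p : Type*} [Fintype p] (B : Matrix n p ℝ) {u : ℝ → p → ℝ} (hu : Continuous u) :
    Continuous fun s => B.mulVec (u s) :=
  Continuous.matrix_mulVec continuous_const hu

/-- The states `∫₀¹ exp (-s A) B u(s) ds` for continuous inputs `u`. -/
noncomputable def steerable (A : Matrix n n ℝ) (B : Matrix n p ℝ) : Submodule ℝ (n → ℝ) where
  carrier := {z | ∃ u : ℝ → p → ℝ, Continuous u ∧
    z = ∫ s in (0 : ℝ)..1, flow A (-s) (B.mulVec (u s))}
  zero_mem' := ⟨fun _ => 0, continuous_const, by simp⟩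
  add_mem' := by
    rintro _ _ ⟨u, hu, rfl⟩ ⟨v, hv, rfl⟩
    refine ⟨fun s => u s + v s, hu.add hv, ?_⟩
    rw [← intervalIntegral.integral_add]
    · simp [Matrix.mulVec_add]
    · exact (((continuous_flow A).comp continuous_neg).clm_apply
        (continuous_mulVec_comp B hu)).intervalIntegrable _ _
    · exact (((continuous_flow A).comp continuous_neg).clm_apply
        (continuous_mulVec_comp B hv)).intervalIntegrable _ _
  smul_mem' := by
    rintro c _ ⟨u, hu, rfl⟩
    refine ⟨fun s => c • u s, hu.const_smul c, ?_⟩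
    rw [← intervalIntegral.integral_smul]
    simp [Matrix.mulVec_smul]

/-- Variation of constants with T = 1: the solution is `flow A t` applied to x₀ plus the integral up
to t, so it ends at x₁ once the integral up to 1 equals `flow A (-1) x₁ - x₀`. -/
theorem isControllable_of_steerable_eq_top {A : Matrix n n ℝ} {B : Matrix n p ℝ}
    (h : steerable A B = ⊤) : IsControllable A B := by
  intro x₀ x₁
  obtain ⟨u, hu, hz⟩ : flow A (-1) x₁ - x₀ ∈ steerable A B := h ▸ Submodule.mem_top
  have hc : Continuous fun s => flow A (-s) (B.mulVec (u s)) :=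
    ((continuous_flow A).comp continuous_neg).clm_apply (continuous_mulVec_comp B hu)
  refine ⟨1, one_pos, u,
    fun t => flow A t (x₀ + ∫ s in (0 : ℝ)..t, flow A (-s) (B.mulVec (u s))),
    hu.continuousOn, fun t _ => ?_, by simp, ?_⟩
  · have hd := hasDerivAt_flow_apply A
      ((intervalIntegral.integral_hasDerivAt_right (hc.intervalIntegrable 0 t)
        hc.aestronglyMeasurable.stronglyMeasurableAtFilter hc.continuousAt).const_add x₀)
    rw [flow_apply_flow_neg] at hd
    exact hd.hasDerivWithinAt
  · simp only [← hz, add_sub_cancel]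
    exact flow_apply_flow_neg A 1 x₁

/-- The functionals `c` with `c ⬝ exp (-s A) B = 0` for all `s ∈ [0,1]`. -/
noncomputable def unsteerable (A : Matrix n n ℝ) (B : Matrix n p ℝ) :
    Submodule ℝ (n → ℝ) where
  carrier := {c | ∀ s ∈ Set.Icc (0 : ℝ) 1, ∀ w, c ⬝ᵥ flow A (-s) (B.mulVec w) = 0}
  zero_mem' := by simp
  add_mem' := by
    intro c d hc hd s hs w
    rw [add_dotProduct, hc s hs w, hd s hs w, add_zero]
  smul_mem' := by
    intro r c hc s hs w
    rw [smul_dotProduct, hc s hs w, smul_zero]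

/-- Differentiate the defining identity in s. At the endpoints only one-sided derivatives are
available, which suffices because derivatives within `[0,1]` are unique. -/
theorem transpose_mulVec_mem_unsteerable {A : Matrix n n ℝ} {B : Matrix n p ℝ} {c : n → ℝ}
    (hc : c ∈ unsteerable A B) : A.transpose.mulVec c ∈ unsteerable A B := by
  intro s hs w
  let φ : (n → ℝ) →L[ℝ] ℝ :=
    LinearMap.toContinuousLinearMap (dotProductBilin ℝ ℝ c)
  have h1 : HasDerivAt (fun t => flow A t (B.mulVec w)) (A.mulVec (flow A (-s) (B.mulVec w)) )
      (-s) := by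
    simpa using hasDerivAt_flow_apply A (hasDerivAt_const (-s) (B.mulVec w))
  have h2 : HasDerivAt (fun t => flow A (-t) (B.mulVec w))
      ((-1 : ℝ) • A.mulVec (flow A (-s) (B.mulVec w))) s :=
    HasDerivAt.scomp s h1 (hasDerivAt_neg s)
  have h3 : HasDerivWithinAt (fun t => c ⬝ᵥ flow A (-t) (B.mulVec w))
      (c ⬝ᵥ ((-1 : ℝ) • A.mulVec (flow A (-s) (B.mulVec w)))) (Set.Icc 0 1) s :=
    (φ.hasFDerivAt.comp_hasDerivAt s h2).hasDerivWithinAt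
  have h4 : HasDerivWithinAt (fun t => c ⬝ᵥ flow A (-t) (B.mulVec w)) 0 (Set.Icc 0 1) s :=
    (hasDerivWithinAt_const s _ (0 : ℝ)).congr (fun t ht => hc t ht w) (hc s hs w)
  have h5 := (uniqueDiffOn_Icc (zero_lt_one' ℝ) s hs).eq_deriv _ h3 h4
  rw [dotProduct_smul, Matrix.dotProduct_mulVec, ← Matrix.mulVec_transpose] at h5
  simpa using h5

theorem transpose_mulVec_eq_zero_of_mem_unsteerable {A : Matrix n n ℝ} {B : Matrix n p ℝ}
    {c : n → ℝ} (hc : c ∈ unsteerable A B) : B.transpose.mulVec c = 0 := by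
  classical
  ext j
  have h : c ⬝ᵥ B.col j = 0 := by simpa using hc 0 (by simp) (Pi.single j 1)
  rw [Matrix.mulVec_transpose]
  exact h

/-- A functional c vanishing on `steerable` is tested on the input u(s) = (c exp(-sA) B)ᵀ. The value
is ∫ |u|² = 0, so by continuity u vanishes on `[0,1]`, that is, c lies in `unsteerable`. -/
theorem steerable_eq_top_of_unsteerable_eq_bot {A : Matrix n n ℝ} {B : Matrix n p ℝ}
    (h : unsteerable A B = ⊥) : steerable A B = ⊤ := by
  classical
  by_contra hne
  obtain ⟨φ, hφ, hle⟩ := Submodule.exists_le_ker_of_lt_top _ (lt_top_iff_ne_top.2 hne)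
  let c : n → ℝ := fun i => φ (Pi.single i 1)
  have hφc : ∀ z, φ z = c ⬝ᵥ z := by
    intro z
    conv_lhs => rw [← Finset.univ_sum_single z]
    simp only [map_sum, dotProduct, c]
    refine Finset.sum_congr rfl fun i _ => ?_
    rw [show Pi.single i (z i) = z i • (Pi.single i 1 : n → ℝ) by
      rw [← Pi.single_smul]; simp, map_smul, smul_eq_mul, mul_comm]
  suffices hc : c ∈ unsteerable A B by
    rw [h, Submodule.mem_bot] at hc
    exact hφ (LinearMap.ext fun z => by simp [hφc, hc])
  let u : ℝ → p → ℝ := fun s j => c ⬝ᵥ flow A (-s) (B.mulVec (Pi.single j 1))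
  have hcf : ∀ w, Continuous fun s => flow A (-s) (B.mulVec w) := fun w =>
    ((continuous_flow A).comp continuous_neg).clm_apply continuous_const
  have hu : Continuous u := continuous_pi fun j =>
    Continuous.dotProduct continuous_const (hcf _)
  have hlin : ∀ s w, c ⬝ᵥ flow A (-s) (B.mulVec w) = u s ⬝ᵥ w := by
    intro s w
    have : w = ∑ j, w j • (Pi.single j 1 : p → ℝ) := by
      conv_lhs => rw [← Finset.univ_sum_single w]
      refine Finset.sum_congr rfl fun j _ => ?_
      rw [← Pi.single_smul]; simp
    conv_lhs => rw [this]
    simp only [Matrix.mulVec_sum, Matrix.mulVec_smul, map_sum, map_smul, dotProduct_sum,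
      dotProduct_smul, smul_eq_mul]
    exact Finset.sum_congr rfl fun j _ => mul_comm _ _
  have hc : Continuous fun s => flow A (-s) (B.mulVec (u s)) :=
    ((continuous_flow A).comp continuous_neg).clm_apply (continuous_mulVec_comp B hu)
  have hint : ∫ s in (0 : ℝ)..1, u s ⬝ᵥ u s = 0 := by
    have h0 : φ (∫ s in (0 : ℝ)..1, flow A (-s) (B.mulVec (u s))) = 0 :=
      hle ⟨u, hu, rfl⟩
    have h1 := (LinearMap.toContinuousLinearMap φ).intervalIntegral_comp_comm
      (μ := MeasureTheory.volume) (hc.intervalIntegrable 0 1)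
    simp only [LinearMap.coe_toContinuousLinearMap', h0, hφc, hlin] at h1
    exact h1
  have hcont : Continuous fun s => u s ⬝ᵥ u s := Continuous.dotProduct hu hu
  have hnonneg : ∀ s, 0 ≤ u s ⬝ᵥ u s := fun s =>
    Finset.sum_nonneg fun j _ => mul_self_nonneg (u s j)
  intro s hs w
  rw [hlin]
  have hzero : u s ⬝ᵥ u s = 0 := by
    by_contra hne
    refine hint.not_gt (intervalIntegral.integral_pos one_pos hcont.continuousOn
      (fun t _ => hnonneg t) ⟨s, hs, lt_of_le_of_ne (hnonneg s) (Ne.symm hne)⟩)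
  rw [dotProduct_self_eq_zero.1 hzero, zero_dotProduct]

theorem isControllable_of_forall_invariant {A : Matrix n n ℝ} {B : Matrix n p ℝ}
    (h : ∀ V : Submodule ℝ (n → ℝ), (∀ c ∈ V, A.transpose.mulVec c ∈ V) →
      (∀ c ∈ V, B.transpose.mulVec c = 0) → V = ⊥) : IsControllable A B :=
  isControllable_of_steerable_eq_top <| steerable_eq_top_of_unsteerable_eq_bot <|
    h _ (fun _ => transpose_mulVec_mem_unsteerable)
      fun _ => transpose_mulVec_eq_zero_of_mem_unsteerable

/-- A controllable system has no proper set of states closed under predecessors and without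
inputs. -/
theorem IsControllable.not_decoupled {A : Matrix n n ℝ} {B : Matrix n p ℝ}
    (h : IsControllable A B) {U : Set n} (hA : ∀ v ∈ U, ∀ w ∉ U, A v w = 0)
    (hB : ∀ v ∈ U, ∀ j, B v j = 0) : U = ∅ := by
  classical
  by_contra hU
  -- The target is the all-ones vector, nonzero at every coordinate of `U`.
  obtain ⟨v, hv⟩ := Set.nonempty_iff_ne_empty.2 hU
  obtain ⟨T, hT, u, x, -, hx, hx0, hxT⟩ := h 0 1
  let y : ℝ → U → ℝ := fun t i => x t i
  let K : (U → ℝ) →L[ℝ] (U → ℝ) := LinearMap.toContinuousLinearMap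
    (A.submatrix (Subtype.val : U → n) Subtype.val).mulVecLin
  have hy : ∀ t ∈ Set.Icc 0 T, HasDerivWithinAt y (K (y t)) (Set.Icc 0 T) t := by
    intro t ht
    rw [hasDerivWithinAt_pi]
    intro i
    convert hasDerivWithinAt_pi.1 (hx t ht) i.1 using 1
    have hBi : B.mulVec (u t) i = 0 := Finset.sum_eq_zero fun j _ => by simp [hB i i.2 j]
    rw [Pi.add_apply, hBi, add_zero]
    change ∑ j : U, A i j * x t j = ∑ j, A i j * x t j
    rw [Finset.sum_set_coe U (f := fun j => A i j * x t j)]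
    exact Finset.sum_subset (Finset.subset_univ _) fun j _ hj => by
      rw [hA i i.2 j (by simpa using hj), zero_mul]
  -- The coordinates in `U` solve y' = K y with y(0) = 0, so Grönwall keeps them at 0.
  have hle : ∀ t ∈ Set.Icc 0 T, ‖y t‖ ≤ gronwallBound 0 ‖K‖ 0 (t - 0) := by
    refine norm_le_gronwallBound_of_norm_deriv_right_le
      (f' := fun t => K (y t)) (fun t ht => (hy t ht).continuousWithinAt) (fun t ht => ?_) ?_ ?_
    · exact ((hy t ⟨ht.1, ht.2.le⟩).mono_of_mem_nhdsWithin
        (Icc_mem_nhdsGE_of_mem ht))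
    · have : y 0 = 0 := by ext i; simp [y, hx0]
      simp [this]
    · intro t _
      simpa using K.le_opNorm (y t)
  have := hle T ⟨hT.le, le_rfl⟩
  rw [gronwallBound_ε0_δ0, norm_le_zero_iff] at this
  have := congrFun this ⟨v, hv⟩
  simp [y, hxT] at this

end Controllability

/-! ### Structural controllability as reachability from the inputs -/

section Structural

variable {n p : Type*} [Fintype n] [Fintype p]

/-- Every state is reached from a state with an input. -/
def IsInputReachable {n p : Type*} (W : StructMatrix n n) (Bbar : StructMatrix n p) : Prop :=
  ∀ v, ∃ r j, Bbar r j = true ∧ Reaches W r v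

theorem IsStructurallyControllable.isInputReachable {W : StructMatrix n n}
    {Bbar : StructMatrix n p} (h : IsStructurallyControllable W Bbar) :
    IsInputReachable W Bbar := by
  obtain ⟨A, B, hA, hB, hc⟩ := h
  have := hc.not_decoupled (U := {v | ¬ ∃ r j, Bbar r j = true ∧ Reaches W r v}) ?_ ?_
  · intro v
    by_contra hv
    exact (Set.eq_empty_iff_forall_notMem.1 this) v hv
  · intro v hv w hw
    refine hA v w (Bool.eq_false_iff.2 fun hvw => hv ?_)
    obtain ⟨r, j, hr, hrw⟩ := not_not.1 hw
    exact ⟨r, j, hr, hrw.tail hvw⟩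
  · intro v hv j
    exact hB v j (Bool.eq_false_iff.2 fun hvj => hv ⟨v, j, hvj, .refl⟩)

/-- A spanning forest of the states rooted at the inputs. -/
theorem IsInputReachable.exists_forest {n p : Type*} {W : StructMatrix n n}
    {Bbar : StructMatrix n p} (h : IsInputReachable W Bbar) :
    ∃ (par : n → n ⊕ p) (depth : n → ℕ),
      (∀ v u, par v = .inl u → W v u = true ∧ depth u < depth v) ∧
      ∀ v j, par v = .inr j → Bbar v j = true := by
  classical
  -- `R k v` describes a walk of exactly `k` edges from an input vertex to `v`; the least such `k`
  -- serves as depth.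
  let R : ℕ → n → Prop := fun k => Nat.rec (motive := fun _ => n → Prop) (fun v => ∃ j, Bbar v j = true)
    (fun _ S v => ∃ u, S u ∧ W v u = true) k
  have hR : ∀ v, ∃ k, R k v := by
    intro v
    obtain ⟨r, j, hr, hrv⟩ := h v
    induction hrv with
    | refl => exact ⟨0, j, hr⟩
    | tail _ huv ih =>
      obtain ⟨k, hk⟩ := ih
      exact ⟨k + 1, _, hk, huv⟩
  have hpar : ∀ v, ∃ q : n ⊕ p,
      (∀ u : n, q = .inl u → W v u = true ∧ Nat.find (hR u) < Nat.find (hR v)) ∧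
      ∀ j, q = .inr j → Bbar v j = true := by
    intro v
    have hs := Nat.find_spec (hR v)
    rcases hk : Nat.find (hR v) with _ | k <;> rw [hk] at hs
    · obtain ⟨j, hj⟩ := hs
      exact ⟨.inr j, by simp, by rintro _ ⟨⟩; exact hj⟩
    · obtain ⟨u, hu, huv⟩ := hs
      refine ⟨.inl u, ?_, by simp⟩
      rintro _ ⟨⟩
      exact ⟨huv, Nat.lt_succ_of_le (Nat.find_le hu)⟩
  choose par hpar using hpar
  exact ⟨par, fun v => Nat.find (hR v), fun v => (hpar v).1, fun v => (hpar v).2⟩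

/-- A forest with distinct loops has no nonzero invariant space of functionals vanishing on the
inputs. -/
theorem eq_bot_of_forest {n p : Type*} [Fintype n] [DecidableEq n] [DecidableEq p] {par : n → n ⊕ p} {depth : n → ℕ}
    {d : n → ℝ} (hd : Function.Injective d) (hpar : ∀ v u, par v = .inl u → depth u < depth v)
    {V : Submodule ℝ (n → ℝ)}
    (hA : ∀ c ∈ V, (fun u => d u * c u + ∑ v with par v = .inl u, c v) ∈ V)
    (hB : ∀ c ∈ V, ∀ j, ∑ v with par v = .inr j, c v = 0) : V = ⊥ := by
  -- The hypothesis makes c an eigenvector of Aᵀ for the eigenvalue `d v`. Away from v, a nonzero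
  -- coordinate requires a nonzero coordinate at some child, so the support lies on the path from v
  -- to its root. Nonvanishing propagates along this path up to the root, whose input then sees a
  -- single nonzero term, contradicting `hB`.
  have heig : ∀ c ∈ V, ∀ v, (∀ u, (d v - d u) * c u = ∑ w with par w = .inl u, c w) →
      c = 0 := by
    intro c hc v hv
    have hstep : ∀ u, c u ≠ 0 → u = v ∨ ∃ w, par w = .inl u ∧ c w ≠ 0 := by
      intro u hu
      by_contra! hne
      have h0 := hv u
      rw [Finset.sum_eq_zero (fun w hw => hne.2 w (Finset.mem_filter.1 hw).2)] at h0
      rcases mul_eq_zero.1 h0 with h1 | h1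
      · exact hne.1 (hd (sub_eq_zero.1 h1)).symm
      · exact hu h1
    let par' : n → n → Prop := fun w u => par w = .inl u
    -- `k` bounds the remaining descent: children are strictly deeper, and depth is at most the
    -- supremum.
    have hpath : ∀ k u, Finset.univ.sup depth < depth u + k → c u ≠ 0 →
        Relation.ReflTransGen par' v u ∧ c v ≠ 0 := by
      intro k
      induction k with
      | zero =>
        intro u hu
        exact absurd (Finset.le_sup (f := depth) (Finset.mem_univ u)) hu.not_ge
      | succ k ih =>
        intro u hk hu
        rcases hstep u hu with rfl | ⟨w, hw, hcw⟩
        · exact ⟨.refl, hu⟩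
        · have := hpar w u hw
          obtain ⟨h1, h2⟩ := ih w (by omega) hcw
          exact ⟨h1.tail hw, h2⟩
    replace hpath : ∀ u, c u ≠ 0 → Relation.ReflTransGen par' v u ∧ c v ≠ 0 :=
      fun u => hpath (Finset.univ.sup depth + 1) u (by omega)
    have hle : ∀ u w, Relation.ReflTransGen par' u w → depth w ≤ depth u := by
      intro u w huw
      induction huw with
      | refl => exact le_rfl
      | tail _ h1 ih => exact (hpar _ _ h1).le.trans ih
    have huniq : Relator.RightUnique par' := fun a b b' h1 h2 => by
      simpa using h1.symm.trans h2
    by_contra hc0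
    obtain ⟨u₀, hu₀⟩ := Function.ne_iff.1 hc0
    have hcv := (hpath u₀ hu₀).2
    -- Only one child of an ancestor lies on the path, so the sum over children collapses to that
    -- child's coordinate.
    have hanc : ∀ u, Relation.ReflTransGen par' v u → c u ≠ 0 := by
      intro u hu
      induction hu with
      | refl => exact hcv
      | @tail u u' hu huu' ih =>
        intro h0
        have h1 := hv u'
        rw [h0, mul_zero, Finset.sum_eq_single u] at h1
        · exact ih h1.symm
        · intro w hw hwu
          by_contra hcw
          have hw' : par' w u' := (Finset.mem_filter.1 hw).2
          rcases Relation.ReflTransGen.total_of_right_unique huniq hu (hpath w hcw).1 with h | h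
          · rcases h.cases_head with h | ⟨x, hx, hxw⟩
            · exact hwu h.symm
            · obtain rfl := huniq huu' hx
              exact (hle _ _ hxw).not_gt (hpar _ _ hw')
          · rcases h.cases_head with h | ⟨x, hx, hxw⟩
            · exact hwu h
            · obtain rfl := huniq hw' hx
              exact (hle _ _ hxw).not_gt (hpar _ _ huu')
        · exact fun h => absurd (Finset.mem_filter.2 ⟨Finset.mem_univ u, huu'⟩) h
    have hroot : ∀ k u, depth u < k → Relation.ReflTransGen par' v u →
        ∃ r j, Relation.ReflTransGen par' v r ∧ par r = .inr j := by
      intro k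
      induction k with
      | zero => simp
      | succ k ih =>
        intro u hk hu
        rcases hq : par u with x | j
        · have := hpar u x hq
          exact ih x (by omega) (hu.tail hq)
        · exact ⟨u, j, hu, hq⟩
    obtain ⟨r, j, hr, hrj⟩ := hroot _ v (Nat.lt_succ_self _) .refl
    have h0 := hB c hc j
    rw [Finset.sum_eq_single r] at h0
    · exact hanc r hr h0
    · intro w hw hwr
      by_contra hcw
      have hend : ∀ a b, par a = .inr j → Relation.ReflTransGen par' a b → a = b := by
        intro a b ha hab
        rcases hab.cases_head with h | ⟨x, hx, -⟩
        · exact h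
        · cases hx.symm.trans ha
      rcases Relation.ReflTransGen.total_of_right_unique huniq hr (hpath w hcw).1 with h | h
      · exact hwr (hend r w hrj h).symm
      · exact hwr (hend w r (Finset.mem_filter.1 hw).2 h)
    · exact fun h => absurd (Finset.mem_filter.2 ⟨Finset.mem_univ r, hrj⟩) h
  -- Induction on a parent-closed support `T`. For v deepest in `T`, the functional (Aᵀ - d v) c is
  -- supported on `T.erase v`, which is still parent-closed; it vanishes by induction, so c is an
  -- eigenvector and `heig` applies.
  have hsupp : ∀ T : Finset n, (∀ v ∈ T, ∀ u, par v = .inl u → u ∈ T) → ∀ c ∈ V,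
      (∀ v ∉ T, c v = 0) → c = 0 := by
    intro T
    induction T using Finset.strongInduction with
    | H T ih =>
      intro hT c hc hcT
      rcases T.eq_empty_or_nonempty with rfl | hne
      · exact funext fun v => hcT v (Finset.notMem_empty v)
      obtain ⟨v, hvT, hmax⟩ := T.exists_max_image depth hne
      have hmem := V.sub_mem (hA c hc) (V.smul_mem (d v) hc)
      have hz := ih (T.erase v) (Finset.erase_ssubset hvT) ?_ _ hmem ?_
      · refine heig c hc v fun u => ?_
        have := congrFun hz u
        simp only [Pi.sub_apply, Pi.smul_apply, smul_eq_mul, Pi.zero_apply] at this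
        linarith
      · intro w hw u hu
        have hwT := Finset.mem_of_mem_erase hw
        refine Finset.mem_erase.2 ⟨?_, hT w hwT u hu⟩
        rintro rfl
        exact (hmax w hwT).not_gt (hpar w u hu)
      · intro u hu
        have hch : ∑ w with par w = .inl u, c w = 0 := by
          refine Finset.sum_eq_zero fun w hw => ?_
          have hw' := (Finset.mem_filter.1 hw).2
          by_contra hcw
          have hwT : w ∈ T := by_contra fun h => hcw (hcT w h)
          have huT := hT w hwT u hw'
          obtain rfl : u = v := by_contra fun h => hu (Finset.mem_erase.2 ⟨h, huT⟩)
          exact (hmax w hwT).not_gt (hpar w u hw')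
        by_cases huv : u = v
        · subst huv
          simp [hch]
        · simp [hch, hcT u fun h => hu (Finset.mem_erase.2 ⟨huv, h⟩)]
  exact (Submodule.eq_bot_iff _).2 fun c hc =>
    hsupp Finset.univ (fun _ _ _ _ => Finset.mem_univ _) c hc fun v hv =>
      absurd (Finset.mem_univ v) hv

theorem IsInputReachable.isStructurallyControllable {W : StructMatrix n n}
    (hW : ∀ i, W i i = true) {Bbar : StructMatrix n p} (h : IsInputReachable W Bbar) :
    IsStructurallyControllable W Bbar := by
  classical
  obtain ⟨par, depth, hn, hp⟩ := h.exists_forest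
  -- The diagonal carries the distinct numbers of an enumeration of the states; this is where the
  -- free diagonal of `W` is needed.
  let d : n → ℝ := fun v => (Fintype.equivFin n v : ℕ)
  have hd : Function.Injective d := fun u v huv =>
    (Fintype.equivFin n).injective (Fin.ext (Nat.cast_injective huv))
  refine ⟨Matrix.diagonal d + Matrix.of fun v u => if par v = .inl u then 1 else 0,
    Matrix.of fun v j => if par v = .inr j then 1 else 0, ?_, ?_, ?_⟩
  · intro v u hvu
    have h1 : v ≠ u := by rintro rfl; simp [hW] at hvu
    have h2 : par v ≠ .inl u := fun h2 => by simp [(hn v u h2).1] at hvu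
    simp [h1, h2]
  · intro v j hvj
    have h2 : par v ≠ .inr j := fun h2 => by simp [hp v j h2] at hvj
    simp [h2]
  · refine isControllable_of_forall_invariant fun V hA hB =>
      eq_bot_of_forest hd (fun v u hvu => (hn v u hvu).2) (fun c hc => ?_) fun c hc j => ?_
    · convert hA c hc using 1
      ext u
      simp [Matrix.transpose_add, Matrix.add_mulVec, Matrix.mulVec_diagonal]
      simp [Matrix.mulVec, dotProduct, Finset.sum_filter]
    · simpa [Matrix.mulVec, dotProduct, Finset.sum_filter] using congrFun (hB c hc) j

theorem isStructurallyControllable_iff {W : StructMatrix n n} (hW : ∀ i, W i i = true)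
    {Bbar : StructMatrix n p} :
    IsStructurallyControllable W Bbar ↔ IsInputReachable W Bbar :=
  ⟨fun h => h.isInputReachable, fun h => h.isStructurallyControllable hW⟩

end Structural

/-! ### Coverings by non-top linked strongly connected components -/

section Covering

variable {n : Type*} {W : StructMatrix n n}

theorem isNonTopLinkedSCC_setOf_reaches {w : n} (hw : ∀ r, Reaches W r w → Reaches W w r) :
    IsNonTopLinkedSCC W {r | Reaches W r w} := by
  refine ⟨⟨⟨⟨w, .refl⟩, fun u hu v hv => hu.trans (hw v hv)⟩, fun T hT hle t ht => ?_⟩, ?_⟩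
  · exact hT.2 t ht w (hle Relation.ReflTransGen.refl)
  · exact fun u hu v hv huv => hu (hv.head huv)

theorem IsNonTopLinkedSCC.mem_of_reaches {C : Set n} (hC : IsNonTopLinkedSCC W C) {r w : n}
    (h : Reaches W r w) (hw : w ∈ C) : r ∈ C := by
  induction h using Relation.ReflTransGen.head_induction_on with
  | refl => exact hw
  | head huv _ ih => exact by_contra fun hu => hC.2 _ hu _ ih huv

theorem IsNonTopLinkedSCC.eq_setOf_reaches {C : Set n} (hC : IsNonTopLinkedSCC W C) {w : n}
    (hw : w ∈ C) : C = {r | Reaches W r w} :=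
  Set.ext fun r => ⟨fun hr => hC.1.1.2 r hr w hw, fun hr => hC.mem_of_reaches hr hw⟩

/-- Among the vertices reaching v, take w with the fewest predecessors. The predecessors of any r
reaching w are among those of w, so by minimality the two sets agree and w reaches r. -/
theorem exists_isNonTopLinkedSCC_reaches [Finite n] (W : StructMatrix n n) (v : n) :
    ∃ C, IsNonTopLinkedSCC W C ∧ ∀ r ∈ C, Reaches W r v := by
  obtain ⟨w, hw, hmin⟩ := Set.exists_min_image {w | Reaches W w v}
    (fun w => {r | Reaches W r w}.ncard) (Set.toFinite _) ⟨v, .refl⟩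
  refine ⟨{r | Reaches W r w}, isNonTopLinkedSCC_setOf_reaches fun r hr => ?_,
    fun r hr => hr.trans hw⟩
  have hsub : {q | Reaches W q r} ⊆ {q | Reaches W q w} := fun q hq => hq.trans hr
  have heq := Set.eq_of_subset_of_ncard_le hsub (hmin r (hr.trans hw))
  have : w ∈ {q | Reaches W q r} := heq ▸ (Relation.ReflTransGen.refl : Reaches W w w)
  exact this

theorem isCover_coverSets_iff {N L k : ℕ} {W : StructMatrix (Fin N) (Fin N)}
    (Bbar : StructMatrix (Fin N) (Fin L))
    (comp : Fin k ≃ {C : Set (Fin N) // IsNonTopLinkedSCC W C}) (J : Finset (Fin L)) :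
    IsCover (coverSets Bbar fun i => (comp i : Set (Fin N))) J ↔
      ∀ v, ∃ r, ∃ j ∈ J, Bbar r j = true ∧ Reaches W r v := by
  simp only [IsCover, Finset.eq_univ_iff_forall, Finset.mem_biUnion, coverSets,
    Finset.mem_filter, Finset.mem_univ, true_and]
  constructor
  · intro h v
    obtain ⟨C, hC, hCv⟩ := exists_isNonTopLinkedSCC_reaches W v
    obtain ⟨j, hj, r, hr, hrC⟩ := h (comp.symm ⟨C, hC⟩)
    rw [Equiv.apply_symm_apply] at hrC
    exact ⟨r, j, hj, hr, hCv r hrC⟩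
  · intro h i
    obtain ⟨v, hv⟩ := (comp i).2.1.1.1
    obtain ⟨r, j, hj, hr, hrv⟩ := h v
    exact ⟨j, hj, r, hr, (comp i).2.mem_of_reaches hrv hv⟩

theorem isStructurallyControllable_selectColumns_iff {N L k : ℕ}
    {W : StructMatrix (Fin N) (Fin N)} (hW : ∀ i, W i i = true)
    (Bbar : StructMatrix (Fin N) (Fin L))
    (comp : Fin k ≃ {C : Set (Fin N) // IsNonTopLinkedSCC W C}) (J : Finset (Fin L)) :
    IsStructurallyControllable W (selectColumns Bbar J) ↔
      IsCover (coverSets Bbar fun i => (comp i : Set (Fin N))) J := by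
  rw [isStructurallyControllable_iff hW, isCover_coverSets_iff]
  refine forall_congr' fun v => exists_congr fun r => ?_
  simp [selectColumns, ← and_assoc]

theorem isCover_univ_iff {N L k : ℕ}
    {W : StructMatrix (Fin N) (Fin N)} (hW : ∀ i, W i i = true)
    (Bbar : StructMatrix (Fin N) (Fin L))
    (comp : Fin k ≃ {C : Set (Fin N) // IsNonTopLinkedSCC W C}) :
    IsCover (coverSets Bbar fun i => (comp i : Set (Fin N))) Finset.univ ↔
      IsStructurallyControllable W Bbar := by
  rw [isStructurallyControllable_iff hW, isCover_coverSets_iff]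
  simp [IsInputReachable]

end Covering

/-! ### Representatives of the non-top linked strongly connected components -/

section Representatives

variable {N : ℕ} (W : StructMatrix (Fin N) (Fin N))

/-- `x_j` reaches `x_i`, for indices given as natural numbers. -/
def ReachedBy (i j : ℕ) : Prop :=
  ∃ (hi : i < N) (hj : j < N), Reaches W ⟨j, hj⟩ ⟨i, hi⟩

/-- All indices related to `v` by `S` are related back to it, and `v` is the least of them. -/
def IsRepresentative (N : ℕ) (S : ℕ → ℕ → Prop) (v : ℕ) : Prop :=
  v < N ∧ ∀ u < N, S v u → S u v ∧ v ≤ u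

variable {W}

theorem ReachedBy.trans {i j k : ℕ} (hij : ReachedBy W i j) (hjk : ReachedBy W j k) :
    ReachedBy W i k := by
  obtain ⟨hi, _, h1⟩ := hij
  obtain ⟨_, hk, h2⟩ := hjk
  exact ⟨hi, hk, h2.trans h1⟩

theorem reachedBy_of_arrayOf_eq_one {i j : ℕ} (h : arrayOf W i j = 1) : ReachedBy W i j := by
  unfold arrayOf at h
  split_ifs at h with h1 h2
  exact ⟨h1.1, h1.2, .single h2⟩

theorem arrayOf_eq_one {m n : ℕ} {M : StructMatrix (Fin m) (Fin n)} {i : Fin m} {j : Fin n} :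
    arrayOf M i j = 1 ↔ M i j = true := by
  simp [arrayOf]

/-- Reachability is the least transitive relation containing the edges; paths of length zero are
covered by the starred diagonal. -/
theorem ReachedBy.of_transitive (hW : ∀ i, W i i = true) {T : ℕ → ℕ → Prop}
    (he : ∀ i < N, ∀ j < N, arrayOf W i j = 1 → T i j)
    (ht : ∀ i < N, ∀ j < N, ∀ k < N, T i j → T j k → T i k) {i j : ℕ}
    (h : ReachedBy W i j) : T i j := by
  obtain ⟨hi, hj, h⟩ := h
  suffices ∀ u v : Fin N, Reaches W u v → T v u from this _ _ h
  intro u v huv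
  induction huv with
  | refl => exact he _ u.2 _ u.2 (arrayOf_eq_one.2 (hW u))
  | tail _ hvw ih =>
    exact ht _ (Fin.is_lt _) _ (Fin.is_lt _) _ u.2
      (he _ (Fin.is_lt _) _ (Fin.is_lt _) (arrayOf_eq_one.2 hvw)) ih

open Classical in
/-- The enumeration of the non-top linked SCCs by their least elements. -/
theorem exists_enumeration (W : StructMatrix (Fin N) (Fin N)) :
    ∃ comp : Fin (Nat.count (IsRepresentative N (ReachedBy W)) N) ≃
        {C : Set (Fin N) // IsNonTopLinkedSCC W C},
      ∀ i : Fin _, ∃ u : Fin N, IsRepresentative N (ReachedBy W) u ∧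
        Nat.count (IsRepresentative N (ReachedBy W)) u = i ∧
        (comp i : Set (Fin N)) = {r | Reaches W r u} := by
  set P := IsRepresentative N (ReachedBy W) with hP
  have hnth : ∀ i : Fin (Nat.count P N), ∃ u : Fin N, P u ∧ Nat.count P u = i := by
    intro i
    have hlt : Nat.nth P i < N := Nat.nth_lt_of_lt_count i.2
    have hfin : {v | P v}.Finite := (Set.finite_Iio N).subset fun v hv => hv.1
    have hcard : (i : ℕ) < hfin.toFinset.card := i.2.trans_le <| by
      rw [Nat.count_eq_card_filter_range]
      exact Finset.card_le_card fun v hv => by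
        exact hfin.mem_toFinset.2 (Finset.mem_filter.1 hv).2
    exact ⟨⟨_, hlt⟩, Nat.nth_mem_of_lt_card hfin hcard, Nat.count_nth fun _ => hcard⟩
  choose u hu hcount using hnth
  have hback : ∀ i r, Reaches W r (u i) → Reaches W (u i) r ∧ (u i : ℕ) ≤ r := by
    intro i r hr
    obtain ⟨⟨_, _, h1⟩, h2⟩ := (hu i).2 r r.2 ⟨(u i).2, r.2, hr⟩
    exact ⟨h1, h2⟩
  let f : Fin (Nat.count P N) → {C : Set (Fin N) // IsNonTopLinkedSCC W C} := fun i =>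
    ⟨{r | Reaches W r (u i)}, isNonTopLinkedSCC_setOf_reaches fun r hr => (hback i r hr).1⟩
  have hf : Function.Bijective f := by
    constructor
    · intro i i' h
      have h' : {r | Reaches W r (u i)} = {r | Reaches W r (u i')} := congrArg Subtype.val h
      have h1 : u i ∈ {r | Reaches W r (u i')} := h' ▸ (.refl : Reaches W (u i) (u i))
      have h2 : u i' ∈ {r | Reaches W r (u i)} := h'.symm ▸ (.refl : Reaches W (u i') (u i'))
      have h3 := le_antisymm (hback i _ h2).2 (hback i' _ h1).2
      exact Fin.ext (by rw [← hcount i, ← hcount i', h3])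
    · rintro ⟨C, hC⟩
      -- The representative of `C` is its least element; closure under predecessors keeps everything
      -- that reaches it inside `C`.
      obtain ⟨w, hw, hmin⟩ := Set.exists_min_image C id (Set.toFinite _) hC.1.1.1
      have hPw : P w := by
        refine ⟨w.2, fun r hr h => ?_⟩
        obtain ⟨_, _, h⟩ := h
        have hrC := hC.mem_of_reaches h hw
        exact ⟨⟨hr, w.2, hC.1.1.2 w hw _ hrC⟩, hmin _ hrC⟩
      refine ⟨⟨Nat.count P w, Nat.count_strict_mono hPw w.2⟩, Subtype.ext ?_⟩
      have : u ⟨Nat.count P w, Nat.count_strict_mono hPw w.2⟩ = w :=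
        Fin.ext (Nat.count_injective (hu _) hPw (hcount _))
      simp only [f, this]
      exact (hC.eq_setOf_reaches hw).symm
  exact ⟨Equiv.ofBijective f hf, fun i : Fin _ => ⟨u i, hu i, hcount i, rfl⟩⟩

end Representatives

/-! ### Warshall's recursion -/

/-- Warshall's relation: `i` and `j` are joined by a walk with all inner vertices below `k`. -/
def JoinedBelow (e : ℕ → ℕ → ℕ) : ℕ → ℕ → ℕ → Prop
  | 0, i, j => e i j = 1
  | k + 1, i, j => JoinedBelow e k i j ∨ JoinedBelow e k i k ∧ JoinedBelow e k k j

/-- At stage `N` this is transitivity on all vertices, so with `ReachedBy.of_transitive` the final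
stage contains reachability. -/
theorem JoinedBelow.trans {e : ℕ → ℕ → ℕ} {k i m j : ℕ} (hm : m < k)
    (h1 : JoinedBelow e k i m) (h2 : JoinedBelow e k m j) : JoinedBelow e k i j := by
  induction k generalizing i m j with
  | zero => exact absurd hm (Nat.not_lt_zero m)
  | succ k ih =>
    simp only [JoinedBelow] at *
    rcases Nat.lt_succ_iff_lt_or_eq.1 hm with hm | rfl
    · have hik := @ih i m k hm
      have hij := @ih i m j hm
      have hkj := @ih k m j hm
      tauto
    · tauto

theorem JoinedBelow.of_eq_one {e : ℕ → ℕ → ℕ} {i j : ℕ} (h : e i j = 1) :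
    ∀ k, JoinedBelow e k i j
  | 0 => h
  | k + 1 => .inl (of_eq_one h k)

theorem ReachedBy.joinedBelow {N : ℕ} {W : StructMatrix (Fin N) (Fin N)}
    (hW : ∀ i, W i i = true) {i j : ℕ} (h : ReachedBy W i j) :
    JoinedBelow (arrayOf W) N i j :=
  h.of_transitive hW (fun _ _ _ _ h => .of_eq_one h N) fun _ _ _ hj _ _ h1 h2 => .trans hj h1 h2

/-! ### Total correctness with a bound on the number of operations -/

theorem Memory.setVar_var (m : Memory) (x v y : ℕ) :
    (m.setVar x v).var y = if y = x then v else m.var y := by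
  simp [Memory.setVar, Function.update_apply]

theorem Memory.setVar_arr (m : Memory) (x v : ℕ) : (m.setVar x v).arr = m.arr := rfl

theorem Memory.setArr_var (m : Memory) (a i j v : ℕ) : (m.setArr a i j v).var = m.var := rfl

theorem Memory.setArr_arr (m : Memory) (a i j v a' i' j' : ℕ) :
    (m.setArr a i j v).arr a' i' j' =
      if a' = a ∧ i' = i ∧ j' = j then v else m.arr a' i' j' := by
  simp only [Memory.setArr, Function.update_apply]
  by_cases h1 : a' = a
  · subst h1
    by_cases h2 : i' = i
    · subst h2
      by_cases h3 : j' = j <;> simp [h3]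
    · simp [h2]
  · simp [h1]

/-- Started in memory `m`, the program `P` halts after at most `T` operations, in a memory
satisfying `Q`. -/
def Achieves (P : Program) (T : ℕ) (Q : Memory → Prop) (m : Memory) : Prop :=
  ∃ (t : ℕ) (m' : Memory), Runs P m t m' ∧ t ≤ T ∧ Q m'

namespace Achieves

variable {P P' : Program} {T T' : ℕ} {Q R : Memory → Prop} {m : Memory}

theorem mono (h : Achieves P T Q m) (hT : T ≤ T') (hQ : ∀ m', Q m' → R m') :
    Achieves P T' R m := by
  obtain ⟨t, m', h1, h2, h3⟩ := h
  exact ⟨t, m', h1, h2.trans hT, hQ _ h3⟩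

theorem seq (h : Achieves P T (Achieves P' T' R) m) : Achieves (.seq P P') (T + T') R m := by
  obtain ⟨t, m', h1, h2, t', m'', h3, h4, h5⟩ := h
  exact ⟨_, _, .seq h1 h3, add_le_add h2 h4, h5⟩

/-- The slack `T` lets branches of different lengths share the bound required by `cond`. -/
theorem skip (h : Q m) : Achieves .skip (T + 1) Q m :=
  ⟨1, _, .skip _, Nat.le_add_left _ _, h⟩

theorem const {x c : ℕ} (h : Q (m.setVar x c)) : Achieves (.const x c) (T + 1) Q m :=
  ⟨1, _, .const .., Nat.le_add_left _ _, h⟩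

theorem copy {x y : ℕ} (h : Q (m.setVar x (m.var y))) : Achieves (.copy x y) (T + 1) Q m :=
  ⟨1, _, .copy .., Nat.le_add_left _ _, h⟩

theorem succ {x : ℕ} (h : Q (m.setVar x (m.var x + 1))) : Achieves (.succ x) (T + 1) Q m :=
  ⟨1, _, .succ .., Nat.le_add_left _ _, h⟩

theorem store {a i j x : ℕ} (h : Q (m.setArr a (m.var i) (m.var j) (m.var x))) :
    Achieves (.store a i j x) (T + 1) Q m :=
  ⟨1, _, .store .., Nat.le_add_left _ _, h⟩

theorem const_seq {x c : ℕ} (h : Achieves P T Q (m.setVar x c)) :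
    Achieves (.seq (.const x c) P) (T + 1) Q m :=
  Nat.add_comm 1 T ▸ seq (const (T := 0) h)

theorem load_seq {x a i j : ℕ}
    (h : Achieves P T Q (m.setVar x (m.arr a (m.var i) (m.var j)))) :
    Achieves (.seq (.load x a i j) P) (T + 1) Q m :=
  Nat.add_comm 1 T ▸ seq ⟨1, _, .load .., le_rfl, h⟩

theorem copy_seq {x y : ℕ} (h : Achieves P T Q (m.setVar x (m.var y))) :
    Achieves (.seq (.copy x y) P) (T + 1) Q m :=
  Nat.add_comm 1 T ▸ seq (copy (T := 0) h)

theorem cond {b : Test} (h1 : b.Holds m → Achieves P T Q m)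
    (h2 : ¬ b.Holds m → Achieves P' T Q m) : Achieves (.cond b P P') (T + 1) Q m := by
  by_cases hb : b.Holds m
  · obtain ⟨t, m', h3, h4, h5⟩ := h1 hb
    exact ⟨_, _, .cond_pos hb h3, Nat.succ_le_succ h4, h5⟩
  · obtain ⟨t, m', h3, h4, h5⟩ := h2 hb
    exact ⟨_, _, .cond_neg hb h3, Nat.succ_le_succ h4, h5⟩

end Achieves

/-- `for x := 0, …, n - 1 do P`. -/
def forLoop (x n : ℕ) (P : Program) : Program :=
  .seq (.const x 0) (.loop (.lt x n) (.seq P (.succ x)))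

/-- `I i` is required once the counter has the value `i`, hence the `setVar` in the step. A round
costs the body, the increment and the test; the final 2 pays for the initialization and the failing
test. -/
theorem Achieves.forLoop {x n : ℕ} {P : Program} {T M : ℕ} {Q : Memory → Prop} {m : Memory}
    (I : ℕ → Memory → Prop) (hxn : n ≠ x) (hn : m.var n = M) (h0 : I 0 (m.setVar x 0))
    (hstep : ∀ i < M, ∀ m', m'.var x = i → m'.var n = M → I i m' →
      Achieves P T (fun m'' => m''.var x = i ∧ m''.var n = M ∧ I (i + 1) (m''.setVar x (i + 1)))
        m')
    (hQ : ∀ m', I M m' → Q m') : Achieves (forLoop x n P) (M * (T + 2) + 2) Q m := by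
  have hloop : ∀ d i, i + d = M → ∀ m', m'.var x = i → m'.var n = M → I i m' →
      Achieves (.loop (.lt x n) (.seq P (.succ x))) (d * (T + 2) + 1) Q m' := by
    intro d
    induction d with
    | zero =>
      intro i hi m' hx hn' hI
      obtain rfl : i = M := by simpa using hi
      refine ⟨1, m', .loop_done ?_, by omega, hQ _ hI⟩
      simp [Test.Holds, hx, hn']
    | succ d ih =>
      intro i hi m' hx hn' hI
      obtain ⟨t, m'', h1, h2, h3, h4, h5⟩ := hstep i (by omega) m' hx hn' hI
      obtain ⟨t', m₃, h6, h7, h8⟩ := ih (i + 1) (by omega) (m''.setVar x (i + 1))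
        (by simp [Memory.setVar_var]) (by simp [Memory.setVar_var, hxn, h4]) h5
      refine ⟨_, m₃, .loop_step ?_ (.seq h1 (.succ m'' x)) (h3 ▸ h6), ?_, h8⟩
      · simp only [Test.Holds, hx, hn']; omega
      · rw [Nat.succ_mul]; omega
  have := hloop M 0 (by simp) (m.setVar x 0) (by simp [Memory.setVar_var])
    (by simp [Memory.setVar_var, hxn, hn]) h0
  exact .const_seq this

/-! ### The algorithm -/

/-- Array `0` becomes its transitive closure. -/
def closureProgram : Program :=
  -- Variables 5, 6, 7 are the pivot, row and column; variable 4 holds the constant 1. Entry (i,j)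
  -- stands for a path from j to i.
  forLoop 5 0 <| forLoop 6 0 <| .seq (.load 8 0 6 5) <| .cond (.eq 8 4)
    (forLoop 7 0 <| .seq (.load 9 0 5 7) <| .cond (.eq 9 4) (.store 0 6 7 4) .skip)
    .skip

/-- Variable `10` becomes `1` if the value of variable `5` is a representative, and `0`
otherwise. -/
def representativeProgram : Program :=
  .seq (.const 10 1) <| forLoop 6 0 <| .seq (.load 8 0 5 6) <| .seq (.load 9 0 6 5) <|
    .cond (.eq 8 4)
      (.cond (.eq 9 4) (.cond (.lt 6 5) (.const 10 0) .skip) (.const 10 0)) .skip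

/-- Writes the column with number variable `2` of the incidence table, for the component
represented by variable `5`. -/
def columnProgram : Program :=
  forLoop 6 1 <| forLoop 7 0 <| .seq (.load 8 1 7 6) <| .seq (.load 9 0 5 7) <|
    .cond (.eq 8 4) (.cond (.eq 9 4) (.store 2 6 2 4) .skip) .skip

/-- The reduction of the constrained problem. -/
def constrainedProgram : Program :=
  .seq (.const 4 1) <| .seq closureProgram <| .seq (.const 2 0) <| .seq (.copy 3 1) <|
    forLoop 5 0 <| .seq representativeProgram <|
      .cond (.eq 10 4) (.seq columnProgram (.succ 2)) .skip

/-- The reduction of the unconstrained problem. -/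
def unconstrainedProgram : Program :=
  .seq (.copy 1 0) <| .seq (.const 4 1) <| .seq (forLoop 5 0 (.store 1 5 5 4)) constrainedProgram

/-! ### Correctness and running time of the programs -/

/-- The memory during the computation of the closure. -/
def ClosureState (N L : ℕ) (b : ℕ → ℕ → ℕ) (S : ℕ → ℕ → Prop) (m : Memory) : Prop :=
  (m.var 0 = N ∧ m.var 1 = L ∧ m.var 4 = 1) ∧ (∀ i j, m.arr 1 i j = b i j) ∧
    (∀ i j, m.arr 2 i j = 0) ∧ ∀ i j, m.arr 0 i j = 1 → S i j

theorem ClosureState.setVar {N L : ℕ} {b : ℕ → ℕ → ℕ} {S : ℕ → ℕ → Prop} {m : Memory}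
    (h : ClosureState N L b S m) {x : ℕ} (hx : 4 < x) (v : ℕ) :
    ClosureState N L b S (m.setVar x v) := by
  have h0 : 0 ≠ x := by omega
  have h1 : 1 ≠ x := by omega
  have h4 : 4 ≠ x := by omega
  simpa [ClosureState, Memory.setVar_var, Memory.setVar_arr, h0, h1, h4] using h

theorem ClosureState.setArr {N L : ℕ} {b : ℕ → ℕ → ℕ} {S : ℕ → ℕ → Prop} {m : Memory}
    (h : ClosureState N L b S m) {i j v : ℕ} (hS : S i j) :
    ClosureState N L b S (m.setArr 0 i j v) := by
  obtain ⟨h1, h2, h3, h4⟩ := h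
  refine ⟨h1, fun i' j' => ?_, fun i' j' => ?_, fun i' j' => ?_⟩
  · simpa [Memory.setArr_arr] using h2 i' j'
  · simpa [Memory.setArr_arr] using h3 i' j'
  · rw [Memory.setArr_arr]
    split_ifs with h
    · rw [h.2.1, h.2.2]
      exact fun _ => hS
    · exact h4 i' j'

/-- Updating in place may put entries ahead of stage `k`, so the array is not exactly `JoinedBelow e
k`. It is sandwiched instead: every entry 1 is justified by the transitive relation `S`, and every
pair joined below `k` has entry 1. For reachability both ends finally coincide. -/
theorem achieves_closureProgram {N L : ℕ} {b e : ℕ → ℕ → ℕ} {S : ℕ → ℕ → Prop}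
    (htrans : ∀ i j k, S i j → S j k → S i k) {m : Memory} (hm : ClosureState N L b S m)
    (he : ∀ i < N, ∀ j < N, e i j = 1 → m.arr 0 i j = 1) :
    Achieves closureProgram (N * (N * (N * (3 + 2) + 2 + 2 + 2) + 2 + 2) + 2)
      (fun m' => ClosureState N L b S m' ∧
        ∀ i < N, ∀ j < N, JoinedBelow e N i j → m'.arr 0 i j = 1) m := by
  refine Achieves.forLoop (fun k m' => ClosureState N L b S m' ∧
    ∀ i < N, ∀ j < N, JoinedBelow e k i j → m'.arr 0 i j = 1) (by decide) hm.1.1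
    ⟨hm.setVar (by decide) _, he⟩ ?_ fun _ h => h
  rintro k hk m₁ h5 h0 ⟨hm₁, hk₁⟩
  refine Achieves.forLoop (fun i' m' => m'.var 5 = k ∧ ClosureState N L b S m' ∧
    (∀ i < N, ∀ j < N, JoinedBelow e k i j → m'.arr 0 i j = 1) ∧
    ∀ i < i', ∀ j < N, JoinedBelow e (k + 1) i j → m'.arr 0 i j = 1) (by decide) h0
    ⟨h5, hm₁.setVar (by decide) _, hk₁, by simp⟩ ?_ ?_
  swap
  · rintro m' ⟨h1, h2, -, h4⟩
    exact ⟨h1, h2.1.1, h2.setVar (by decide) _, h4⟩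
  rintro i hi m₂ h6 - ⟨h5₂, hm₂, hk₂, hi₂⟩
  refine .load_seq (.cond (fun hb => ?_) fun hb => ?_)
  swap
  · refine .skip ?_
    have hb' : m₂.arr 0 i k ≠ 1 := by
      simpa [Test.Holds, Memory.setVar_var, h6, h5₂, hm₂.1.2.2] using hb
    refine ⟨h6, hm₂.1.1, h5₂, (hm₂.setVar (by decide) _).setVar (by decide) _, hk₂, ?_⟩
    intro i' hi' j hj hij
    rcases Nat.lt_succ_iff_lt_or_eq.1 hi' with hi' | rfl
    · exact hi₂ i' hi' j hj hij
    · rcases hij with hij | hij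
      · exact hk₂ i' hi j hj hij
      · exact absurd (hk₂ i' hi k hk hij.1) hb'
  have hik : m₂.arr 0 i k = 1 := by
    simpa [Test.Holds, Memory.setVar_var, h6, h5₂, hm₂.1.2.2] using hb
  refine Achieves.forLoop (fun j' m' => (m'.var 5 = k ∧ m'.var 6 = i) ∧ ClosureState N L b S m' ∧
    (∀ i < N, ∀ j < N, JoinedBelow e k i j → m'.arr 0 i j = 1) ∧
    (∀ i' < i, ∀ j < N, JoinedBelow e (k + 1) i' j → m'.arr 0 i' j = 1) ∧
    ∀ j < j', JoinedBelow e (k + 1) i j → m'.arr 0 i j = 1) (by decide) hm₂.1.1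
    ⟨⟨h5₂, h6⟩, (hm₂.setVar (by decide) _).setVar (by decide) _, hk₂, hi₂, by simp⟩ ?_ ?_
  swap
  · rintro m' ⟨⟨h1, h2⟩, h3, h4, h5, h6⟩
    refine ⟨h2, h3.1.1, h1, h3.setVar (by decide) _, h4, fun i' hi' => ?_⟩
    rcases Nat.lt_succ_iff_lt_or_eq.1 hi' with hi' | rfl
    · exact h5 i' hi'
    · exact h6
  rintro j hj m₃ h7 - ⟨⟨h5₃, h6₃⟩, hm₃, hk₃, hi₃, hj₃⟩
  refine .load_seq (.cond (fun hb => .store ?_) fun hb => .skip ?_)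
  · have hkj : m₃.arr 0 k j = 1 := by
      simpa [Test.Holds, Memory.setVar_var, h7, h5₃, hm₃.1.2.2] using hb
    have hS := htrans _ _ _ (hm₂.2.2.2 i k hik) (hm₃.2.2.2 k j hkj)
    have hset : ∀ m' : Memory, m'.var 6 = i → m'.var 7 = j → m'.var 4 = 1 →
        m'.setArr 0 (m'.var 6) (m'.var 7) (m'.var 4) = m'.setArr 0 i j 1 := by
      intro m' h1 h2 h3
      rw [h1, h2, h3]
    rw [hset (m₃.setVar 9 _) h6₃ h7 hm₃.1.2.2]
    have hmono : ∀ i' j', m₃.arr 0 i' j' = 1 → ∀ x v y w,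
        (((m₃.setVar x v).setArr 0 i j 1).setVar y w).arr 0 i' j' = 1 := by
      intro i' j' h x v y w
      rw [Memory.setVar_arr, Memory.setArr_arr]
      split_ifs
      · rfl
      · exact h
    refine ⟨h7, hm₃.1.1, ⟨h5₃, h6₃⟩, ((hm₃.setVar (by decide) _).setArr hS).setVar (by decide) _,
      fun i' hi' j' hj' h => hmono _ _ (hk₃ i' hi' j' hj' h) _ _ _ _,
      fun i' hi' j' hj' h => hmono _ _ (hi₃ i' hi' j' hj' h) _ _ _ _, fun j' hj' h => ?_⟩
    rcases Nat.lt_succ_iff_lt_or_eq.1 hj' with hj' | rfl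
    · exact hmono _ _ (hj₃ j' hj' h) _ _ _ _
    · simp [Memory.setVar_arr, Memory.setArr_arr]
  · have hkj : m₃.arr 0 k j ≠ 1 := by
      simpa [Test.Holds, Memory.setVar_var, h7, h5₃, hm₃.1.2.2] using hb
    refine ⟨h7, hm₃.1.1, ⟨h5₃, h6₃⟩, (hm₃.setVar (by decide) _).setVar (by decide) _,
      hk₃, hi₃, fun j' hj' h => ?_⟩
    rcases Nat.lt_succ_iff_lt_or_eq.1 hj' with hj' | rfl
    · exact hj₃ j' hj' h
    · rcases h with h | h
      · exact hk₃ i hi j' hj h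
      · exact absurd (hk₃ k hk j' hj h.2) hkj

/-- The memory after the computation of the closure. -/
def ScanState (N L : ℕ) (b : ℕ → ℕ → ℕ) (S : ℕ → ℕ → Prop) (m : Memory) : Prop :=
  (m.var 0 = N ∧ m.var 1 = L ∧ m.var 3 = L ∧ m.var 4 = 1) ∧ (∀ i j, m.arr 1 i j = b i j) ∧
    ∀ i < N, ∀ j < N, m.arr 0 i j = 1 ↔ S i j

theorem ScanState.setVar {N L : ℕ} {b : ℕ → ℕ → ℕ} {S : ℕ → ℕ → Prop} {m : Memory}
    (h : ScanState N L b S m) {x : ℕ} (hx : x = 2 ∨ 4 < x) (v : ℕ) :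
    ScanState N L b S (m.setVar x v) := by
  have h0 : 0 ≠ x := by omega
  have h1 : 1 ≠ x := by omega
  have h3 : 3 ≠ x := by omega
  have h4 : 4 ≠ x := by omega
  simpa [ScanState, Memory.setVar_var, Memory.setVar_arr, h0, h1, h3, h4] using h

theorem ScanState.setArr {N L : ℕ} {b : ℕ → ℕ → ℕ} {S : ℕ → ℕ → Prop} {m : Memory}
    (h : ScanState N L b S m) (i j v : ℕ) : ScanState N L b S (m.setArr 2 i j v) := by
  simpa [ScanState, Memory.setArr_var, Memory.setArr_arr] using h

section Scan

variable {N L : ℕ} {b : ℕ → ℕ → ℕ} {S : ℕ → ℕ → Prop} {m : Memory}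

/-- The flag in variable 10 starts at 1 and can only be lowered, by a u that reaches v but is not
reached back or is smaller. A body costs at most 6: two loads, three tests, one assignment. -/
theorem achieves_representativeProgram {v : ℕ} (hv : v < N) (hm : ScanState N L b S m)
    (h5 : m.var 5 = v) :
    Achieves representativeProgram (N * (6 + 2) + 2 + 1)
      (fun m' => ScanState N L b S m' ∧ m'.var 5 = v ∧ m'.var 2 = m.var 2 ∧ m'.arr 2 = m.arr 2 ∧
        (m'.var 10 = 1 ↔ IsRepresentative N S v)) m := by
  refine .const_seq (Achieves.forLoop (fun u m' => ScanState N L b S m' ∧ m'.var 5 = v ∧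
    m'.var 2 = m.var 2 ∧ m'.arr 2 = m.arr 2 ∧
    (m'.var 10 = 1 ↔ ∀ u' < u, S v u' → S u' v ∧ v ≤ u')) (by decide) hm.1.1
    ⟨(hm.setVar (by decide) _).setVar (by decide) _, h5, rfl, rfl, ?_⟩ ?_ ?_)
  · simp [Memory.setVar_var]
  · rintro u hu m₁ h6 h0 ⟨hm₁, h5₁, h2₁, ha₁, h10⟩
    have h4 := hm₁.1.2.2.2
    have hstep : (∀ u' < u + 1, S v u' → S u' v ∧ v ≤ u') ↔
        m₁.var 10 = 1 ∧ (S v u → S u v ∧ v ≤ u) := by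
      rw [h10]
      exact Nat.forall_lt_succ_right
    simp only [hstep]
    have hvu := hm₁.2.2 v hv u hu
    have huv := hm₁.2.2 u hu v hv
    refine .load_seq (.load_seq (.cond (fun h8 => ?_) fun h8 => .skip ?_))
    · replace h8 : S v u := by
        simpa [Test.Holds, Memory.setVar_var, h4, h5₁, h6, hvu] using h8
      refine .cond (fun h9 => ?_) fun h9 => .const ?_
      · replace h9 : S u v := by
          simpa [Test.Holds, Memory.setVar_var, Memory.setVar_arr, h4, h5₁, h6, huv] using h9
        refine .cond (fun hlt => .const ?_) fun hlt => .skip ?_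
        · replace hlt : u < v := by
            simpa [Test.Holds, Memory.setVar_var, h5₁, h6] using hlt
          refine ⟨h6, h0, (((hm₁.setVar (by decide) _).setVar (by decide) _).setVar
            (by decide) _).setVar (by decide) _, h5₁, h2₁, ha₁, ?_⟩
          simp [Memory.setVar_var, h8, hlt]
        · replace hlt : v ≤ u := by
            simpa [Test.Holds, Memory.setVar_var, h5₁, h6] using hlt
          refine ⟨h6, h0, ((hm₁.setVar (by decide) _).setVar (by decide) _).setVar
            (by decide) _, h5₁, h2₁, ha₁, ?_⟩
          simp [Memory.setVar_var, h9, hlt]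
      · replace h9 : ¬ S u v := by
          simpa [Test.Holds, Memory.setVar_var, Memory.setVar_arr, h4, h5₁, h6, huv] using h9
        refine ⟨h6, h0, (((hm₁.setVar (by decide) _).setVar (by decide) _).setVar
          (by decide) _).setVar (by decide) _, h5₁, h2₁, ha₁, ?_⟩
        simp [Memory.setVar_var, h8, h9]
    · replace h8 : ¬ S v u := by
        simpa [Test.Holds, Memory.setVar_var, h4, h5₁, h6, hvu] using h8
      refine ⟨h6, h0, ((hm₁.setVar (by decide) _).setVar (by decide) _).setVar
        (by decide) _, h5₁, h2₁, ha₁, ?_⟩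
      simp [Memory.setVar_var, h8]
  · rintro m' ⟨h1, h2, h3, h4, h5⟩
    exact ⟨h1, h2, h3, h4, h5.trans ⟨fun h => ⟨hv, h⟩, fun h => h.2⟩⟩

-- The program only ever writes ones; the zeros of the new column are those already in the table,
-- which is why `TableState` also records that unused columns vanish.
open Classical in
theorem achieves_columnProgram {v c : ℕ} (hv : v < N) (hm : ScanState N L b S m)
    (h5 : m.var 5 = v) (h2 : m.var 2 = c) :
    Achieves columnProgram (L * (N * (5 + 2) + 2 + 2) + 2)
      (fun m' => ScanState N L b S m' ∧ m'.var 5 = v ∧ m'.var 2 = c ∧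
        ∀ j i, m'.arr 2 j i = if i = c ∧ j < L ∧ ∃ r < N, b r j = 1 ∧ S v r then 1
          else m.arr 2 j i) m := by
  refine Achieves.forLoop (fun j m' => ScanState N L b S m' ∧ m'.var 5 = v ∧ m'.var 2 = c ∧
    ∀ j' i, m'.arr 2 j' i = if i = c ∧ j' < j ∧ ∃ r < N, b r j' = 1 ∧ S v r then 1
      else m.arr 2 j' i) (by decide) hm.1.2.1
    ⟨hm.setVar (by decide) _, h5, h2, by simp [Memory.setVar_arr]⟩ ?_ fun _ h => h
  rintro j hj m₁ h6 h1 ⟨hm₁, h5₁, h2₁, ht₁⟩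
  -- Rows before `j` are complete, while row `j` accounts only for the states below `r`.
  refine Achieves.forLoop (fun r m' => m'.var 6 = j ∧ ScanState N L b S m' ∧ m'.var 5 = v ∧
    m'.var 2 = c ∧ ∀ j' i, m'.arr 2 j' i = if i = c ∧
      (j' < j ∧ (∃ r < N, b r j' = 1 ∧ S v r) ∨ j' = j ∧ ∃ r' < r, b r' j' = 1 ∧ S v r') then 1
      else m.arr 2 j' i) (by decide) hm₁.1.1
    ⟨h6, hm₁.setVar (by decide) _, h5₁, h2₁, by simpa [Memory.setVar_arr] using ht₁⟩ ?_ ?_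
  swap
  · rintro m' ⟨h6', hm', h5', h2', ht'⟩
    refine ⟨h6', hm'.1.2.1, hm'.setVar (by decide) _, h5', h2', fun j' i => ?_⟩
    rw [Memory.setVar_arr, ht']
    refine if_congr (and_congr_right fun _ => ?_) rfl rfl
    rw [Nat.lt_succ_iff_lt_or_eq, or_and_right]
  rintro r hr m₂ h7 h0 ⟨h6₂, hm₂, h5₂, h2₂, ht₂⟩
  have h4 := hm₂.1.2.2.2
  have hvr := hm₂.2.2 v hv r hr
  simp only [Nat.exists_lt_succ_right]
  have hskip : ¬ (b r j = 1 ∧ S v r) → ∀ x y : ℕ,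
      (fun m'' : Memory => m''.var 7 = r ∧ m''.var 0 = N ∧
        (m''.setVar 7 (r + 1)).var 6 = j ∧ ScanState N L b S (m''.setVar 7 (r + 1)) ∧
        (m''.setVar 7 (r + 1)).var 5 = v ∧ (m''.setVar 7 (r + 1)).var 2 = c ∧
        ∀ j' i, (m''.setVar 7 (r + 1)).arr 2 j' i = if i = c ∧
          (j' < j ∧ (∃ r < N, b r j' = 1 ∧ S v r) ∨
            j' = j ∧ ((∃ r' < r, b r' j' = 1 ∧ S v r') ∨ b r j' = 1 ∧ S v r)) then 1
          else m.arr 2 j' i) ((m₂.setVar 8 x).setVar 9 y) := by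
    intro hne x y
    refine ⟨h7, h0, h6₂, ((hm₂.setVar (by decide) _).setVar (by decide) _).setVar (by decide) _,
      h5₂, h2₂, fun j' i => ?_⟩
    simp only [Memory.setVar_arr]
    rw [ht₂]
    refine if_congr (and_congr_right fun _ => or_congr_right (and_congr_right ?_)) rfl rfl
    rintro rfl
    simp [hne]
  refine .load_seq (.load_seq (.cond (fun h8 => ?_) fun h8 => .skip (hskip ?_ _ _)))
  · replace h8 : b r j = 1 := by
      simpa [Test.Holds, Memory.setVar_var, h4, h6₂, h7, hm₂.2.1] using h8
    refine .cond (fun h9 => .store ?_) fun h9 => .skip (hskip ?_ _ _)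
    · replace h9 : S v r := by
        simpa [Test.Holds, Memory.setVar_var, Memory.setVar_arr, h4, h5₂, h7, hvr] using h9
      refine ⟨h7, h0, h6₂, (((hm₂.setVar (by decide) _).setVar (by decide) _).setArr
        _ _ _).setVar (by decide) _, h5₂, h2₂, fun j' i => ?_⟩
      simp only [Memory.setVar_arr, Memory.setArr_arr, Memory.setVar_var, h6₂, h2₂, h4, ht₂]
      norm_num
      by_cases hi : i = c
      · by_cases hj' : j' = j
        · subst hj'
          simp [hi, h8, h9]
        · simp [hi, hj']
      · simp [hi]
    · have : ¬ S v r := by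
        simpa [Test.Holds, Memory.setVar_var, Memory.setVar_arr, h4, h5₂, h7, hvr] using h9
      exact fun h => this h.2
  · have : ¬ b r j = 1 := by
      simpa [Test.Holds, Memory.setVar_var, h4, h6₂, h7, hm₂.2.1] using h8
    exact fun h => this h.1

open Classical in
/-- The columns of the incidence table belonging to representatives below `v` are filled. -/
def TableState (N L : ℕ) (b : ℕ → ℕ → ℕ) (S : ℕ → ℕ → Prop) (v : ℕ) (m : Memory) : Prop :=
  (∀ j < L, ∀ u < v, IsRepresentative N S u →
    m.arr 2 j (Nat.count (IsRepresentative N S) u) =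
      if ∃ r < N, b r j = 1 ∧ S u r then 1 else 0) ∧
  ∀ j < L, ∀ i, Nat.count (IsRepresentative N S) v ≤ i → m.arr 2 j i = 0

-- Variable 2 is both the number of representatives found and the next free column, so a
-- representative u owns column `Nat.count _ u`. The hypotheses `he` and `hjoin` close the sandwich,
-- making array 0 equal to `S` after the closure.
open Classical in
theorem achieves_constrainedProgram {e : ℕ → ℕ → ℕ}
    (htrans : ∀ i j k, S i j → S j k → S i k)
    (he : ∀ i j, e i j = 1 → S i j)
    (hjoin : ∀ i j, S i j → JoinedBelow e N i j)
    (h0 : m.var 0 = N) (h1 : m.var 1 = L) (ha0 : ∀ i j, m.arr 0 i j = e i j)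
    (ha1 : ∀ i j, m.arr 1 i j = b i j) (ha2 : ∀ i j, m.arr 2 i j = 0) :
    Achieves constrainedProgram
      ((N * (N * (N * (3 + 2) + 2 + 2 + 2) + 2 + 2) + 2) +
        (N * ((N * (6 + 2) + 2 + 1) + (L * (N * (5 + 2) + 2 + 2) + 2 + 1 + 1) + 2) + 2
          + 1 + 1) + 1)
      (fun m' => m'.var 2 = Nat.count (IsRepresentative N S) N ∧ m'.var 3 = L ∧
        TableState N L b S N m') m := by
  refine .const_seq (.seq ((achieves_closureProgram (e := e) (m := m.setVar 4 1) htrans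
    ⟨⟨h0, h1, rfl⟩, ha1, ha2, fun i j h => he i j (ha0 i j ▸ h)⟩
    fun i _ j _ h => (ha0 i j).trans h).mono le_rfl ?_))
  rintro m₁ ⟨hm₁, hj₁⟩
  refine .const_seq (.copy_seq (Achieves.forLoop (fun v m' => ScanState N L b S m' ∧
    m'.var 2 = Nat.count (IsRepresentative N S) v ∧ TableState N L b S v m') (by decide)
    hm₁.1.1 ⟨⟨⟨hm₁.1.1, hm₁.1.2.1, hm₁.1.2.1, hm₁.1.2.2⟩, hm₁.2.1, fun i hi j hj =>
      ⟨hm₁.2.2.2 i j, fun h => hj₁ i hi j hj (hjoin i j h)⟩⟩, ?_, ?_⟩ ?_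
    fun m' h => ⟨h.2.1, h.1.1.2.2.1, h.2.2⟩))
  · simp [Memory.setVar_var]
  · exact ⟨by simp, fun j _ i _ => hm₁.2.2.1 j i⟩
  rintro v hv m₂ h5 - ⟨hm₂, h2, ht⟩
  refine .seq ((achieves_representativeProgram hv hm₂ h5).mono le_rfl ?_)
  rintro m₃ ⟨hm₃, h5₃, h2₃, ha₃, h10⟩
  rw [h2] at h2₃
  refine .cond (fun hb => ?_) fun hb => .mono (.skip (T := 0) ?_) (Nat.le_add_left _ _) fun _ h => h
  · have hP : IsRepresentative N S v := h10.1 (hb.trans hm₃.1.2.2.2)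
    refine .seq (T := L * (N * (5 + 2) + 2 + 2) + 2) (T' := 0 + 1)
      ((achieves_columnProgram hv hm₃ h5₃ h2₃).mono le_rfl ?_)
    rintro m₄ ⟨hm₄, h5₄, h2₄, ht₄⟩
    have hcount : Nat.count (IsRepresentative N S) (v + 1) =
        Nat.count (IsRepresentative N S) v + 1 := by
      rw [Nat.count_succ, if_pos hP]
    refine .succ (T := 0) ⟨h5₄, hm₄.1.1, (hm₄.setVar (by decide) _).setVar (by decide) _, ?_, ?_, ?_⟩
    · simp [Memory.setVar_var, h2₄, hcount]
    · intro j hj u hu hPu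
      simp only [Memory.setVar_arr, ht₄, ha₃]
      rcases Nat.lt_succ_iff_lt_or_eq.1 hu with hu | rfl
      -- An earlier representative has a strictly smaller count, so its column is untouched.
      · rw [if_neg fun h => (Nat.count_strict_mono hPu hu).ne h.1]
        exact ht.1 j hj u hu hPu
      · simp [hj, ht.2 j hj _ le_rfl]
    · intro j hj i hi
      simp only [Memory.setVar_arr, ht₄, ha₃]
      rw [hcount] at hi
      rw [if_neg (by omega)]
      exact ht.2 j hj i (by omega)
  · have hP : ¬ IsRepresentative N S v := fun h => hb ((h10.2 h).trans hm₃.1.2.2.2.symm)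
    have hcount : Nat.count (IsRepresentative N S) (v + 1) =
        Nat.count (IsRepresentative N S) v := by
      rw [Nat.count_succ, if_neg hP, add_zero]
    refine ⟨h5₃, hm₃.1.1, hm₃.setVar (by decide) _, h2₃.trans hcount.symm, ?_, ?_⟩
    · intro j hj u hu hPu
      rw [Memory.setVar_arr, ha₃]
      rcases Nat.lt_succ_iff_lt_or_eq.1 hu with hu | rfl
      · exact ht.1 j hj u hu hPu
      · exact absurd hPu hP
    · intro j hj i hi
      rw [Memory.setVar_arr, ha₃]
      exact ht.2 j hj i (hcount ▸ hi)

end Scan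

/-! ### The reductions -/

section Reduction

open Polynomial

/-- A bound on the number of operations of `constrainedProgram`. -/
def constrainedCost (N L : ℕ) : ℕ :=
  (N * (N * (N * (3 + 2) + 2 + 2 + 2) + 2 + 2) + 2) +
    (N * ((N * (6 + 2) + 2 + 1) + (L * (N * (5 + 2) + 2 + 2) + 2 + 1 + 1) + 2) + 2 + 1 + 1) + 1

/-- `constrainedCost` with both arguments equal. -/
noncomputable def constrainedCostPoly : Polynomial ℕ :=
  (X * (X * (X * (3 + 2) + 2 + 2 + 2) + 2 + 2) + 2) +
    (X * ((X * (6 + 2) + 2 + 1) + (X * (X * (5 + 2) + 2 + 2) + 2 + 1 + 1) + 2) + 2 + 1 + 1) + 1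

theorem eval_constrainedCostPoly (n : ℕ) :
    constrainedCostPoly.eval n = constrainedCost n n := by
  simp [constrainedCostPoly, constrainedCost]

/-- The cost is monotone in both arguments, so a one-variable polynomial in N + L suffices. -/
theorem constrainedCost_le (N L : ℕ) :
    constrainedCost N L ≤ constrainedCost (N + L) (N + L) := by
  have hN : N ≤ N + L := Nat.le_add_right N L
  have hL : L ≤ N + L := Nat.le_add_left L N
  unfold constrainedCost
  gcongr

variable {N L : ℕ} {W : StructMatrix (Fin N) (Fin N)} {Bbar : StructMatrix (Fin N) (Fin L)}

open Classical in
theorem holdsSetCover_of_tableState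
    (comp : Fin (Nat.count (IsRepresentative N (ReachedBy W)) N) ≃
        {C : Set (Fin N) // IsNonTopLinkedSCC W C})
    (hcomp : ∀ i : Fin _, ∃ u : Fin N, IsRepresentative N (ReachedBy W) u ∧
        Nat.count (IsRepresentative N (ReachedBy W)) u = i ∧
        (comp i : Set (Fin N)) = {r | Reaches W r u})
    {m : Memory} (h2 : m.var 2 = Nat.count (IsRepresentative N (ReachedBy W)) N)
    (h3 : m.var 3 = L) (ht : TableState N L (arrayOf Bbar) (ReachedBy W) N m) :
    HoldsSetCover m (coverSets Bbar fun i => (comp i : Set (Fin N))) := by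
  refine ⟨h2, h3, fun j i => ?_⟩
  obtain ⟨u, hu, hui, hcu⟩ := hcomp i
  rw [← hui, ht.1 j j.2 u u.2 hu]
  refine if_congr ?_ rfl rfl
  simp only [coverSets, Finset.mem_filter, Finset.mem_univ, true_and, hcu]
  constructor
  · rintro ⟨r, hr, hb, _, _, hur⟩
    exact ⟨⟨r, hr⟩, arrayOf_eq_one.1 hb, hur⟩
  · rintro ⟨r, hb, hur⟩
    exact ⟨r, r.2, arrayOf_eq_one.2 hb, u.2, r.2, hur⟩

open Classical in
theorem achieves_constrainedProgram_of_arrayOf (hW : ∀ i, W i i = true) {m : Memory}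
    (h0 : m.var 0 = N) (h1 : m.var 1 = L) (ha0 : ∀ i j, m.arr 0 i j = arrayOf W i j)
    (ha1 : ∀ i j, m.arr 1 i j = arrayOf Bbar i j) (ha2 : ∀ i j, m.arr 2 i j = 0) :
    Achieves constrainedProgram (constrainedCost N L)
      (fun m' => m'.var 2 = Nat.count (IsRepresentative N (ReachedBy W)) N ∧ m'.var 3 = L ∧
        TableState N L (arrayOf Bbar) (ReachedBy W) N m') m :=
  achieves_constrainedProgram (fun _ _ _ => .trans) (fun _ _ => reachedBy_of_arrayOf_eq_one)
    (fun _ _ h => h.joinedBelow hW) h0 h1 ha0 ha1 ha2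

theorem arrayOf_dedicatedInputs (N i j : ℕ) :
    arrayOf (dedicatedInputs N) i j = if i = j ∧ i < N then 1 else 0 := by
  unfold arrayOf dedicatedInputs
  split_ifs <;> simp_all
  omega

open Classical in
theorem achieves_unconstrainedProgram (hW : ∀ i, W i i = true) :
    Achieves unconstrainedProgram (N * (0 + 1 + 2) + 2 + constrainedCost N N + 1 + 1)
      (fun m' => m'.var 2 = Nat.count (IsRepresentative N (ReachedBy W)) N ∧ m'.var 3 = N ∧
        TableState N N (arrayOf (dedicatedInputs N)) (ReachedBy W) N m')
      (unconstrainedInput W) := by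
  refine .copy_seq (.const_seq (.seq (Achieves.forLoop (fun i m' => m'.var 0 = N ∧
    m'.var 1 = N ∧ m'.var 4 = 1 ∧ (∀ i j, m'.arr 0 i j = arrayOf W i j) ∧
    (∀ i' j', m'.arr 1 i' j' = if i' = j' ∧ i' < i then 1 else 0) ∧
    ∀ i j, m'.arr 2 i j = 0) (by decide) rfl ?_ ?_ ?_)))
  · simp [Memory.setVar_var, Memory.setVar_arr, unconstrainedInput]
  · rintro i hi m' h5 - ⟨h0, h1, h4, ha0, ha1, ha2⟩
    refine .store ⟨h5, h0, h0, h1, h4, fun i' j' => ?_, fun i' j' => ?_, fun i' j' => ?_⟩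
    · simp [Memory.setVar_arr, Memory.setArr_arr, ha0]
    · simp only [Memory.setVar_arr, Memory.setArr_arr, ha1, h5, h4, true_and]
      split_ifs <;> first | rfl | omega
    · simp [Memory.setVar_arr, Memory.setArr_arr, ha2]
  · rintro m' ⟨h0, h1, -, ha0, ha1, ha2⟩
    exact achieves_constrainedProgram_of_arrayOf hW h0 h1 ha0
      (fun i j => (ha1 i j).trans (arrayOf_dedicatedInputs N i j).symm) ha2

end Reduction

end LeaderSelection

open LeaderSelection
theorem mainTheorem5 :
    -- the unconstrained problem, with dedicated inputs
    (∃ (P : Program) (q : Polynomial ℕ), ∀ (N : ℕ) (W : StructMatrix (Fin N) (Fin N)),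
      (∀ i, W i i = true) →
      ∃ (k : ℕ) (comp : Fin k ≃ {C : Set (Fin N) // IsNonTopLinkedSCC W C})
        (S : Fin N → Finset (Fin k)),
        S = coverSets (dedicatedInputs N) (fun i => (comp i : Set (Fin N))) ∧
        (∃ (t : ℕ) (m : Memory), Runs P (unconstrainedInput W) t m ∧
          t ≤ q.eval N ∧ HoldsSetCover m S) ∧
        IsCover S Finset.univ ∧
        (∀ J : Finset (Fin N),
          IsStructurallyControllable W (selectColumns (dedicatedInputs N) J) ↔ IsCover S J) ∧
        (∀ J : Finset (Fin N), SolvesUnconstrained W J ↔ SolvesMinSetCover S J)) ∧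
    -- the constrained problem, with a given input matrix
    (∃ (P : Program) (q : Polynomial ℕ), ∀ (N L : ℕ) (W : StructMatrix (Fin N) (Fin N))
      (Bbar : StructMatrix (Fin N) (Fin L)),
      (∀ i, W i i = true) →
      ∃ (k : ℕ) (comp : Fin k ≃ {C : Set (Fin N) // IsNonTopLinkedSCC W C})
        (S : Fin L → Finset (Fin k)),
        S = coverSets Bbar (fun i => (comp i : Set (Fin N))) ∧
        (∃ (t : ℕ) (m : Memory), Runs P (constrainedInput W Bbar) t m ∧
          t ≤ q.eval (N + L) ∧ HoldsSetCover m S) ∧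
        (IsCover S Finset.univ ↔ IsStructurallyControllable W Bbar) ∧
        (∀ J : Finset (Fin L),
          IsStructurallyControllable W (selectColumns Bbar J) ↔ IsCover S J) ∧
        (∀ J : Finset (Fin L), SolvesConstrained W Bbar J ↔ SolvesMinSetCover S J)) := by
  constructor
  -- The summand 3N + 2 pays for writing the diagonal of 𝕀_N into array 1, the last two units for
  -- the two initial assignments.
  · refine ⟨unconstrainedProgram, Polynomial.X * 3 + 2 + constrainedCostPoly + 1 + 1,
      fun N W hW => ?_⟩
    obtain ⟨comp, hcomp⟩ := exists_enumeration W
    have hiff := isStructurallyControllable_selectColumns_iff hW (dedicatedInputs N) comp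
    refine ⟨_, comp, _, rfl, ?_, ?_, hiff, fun J => ?_⟩
    · obtain ⟨t, m, hrun, ht, h2, h3, htab⟩ := achieves_unconstrainedProgram hW
      refine ⟨t, m, hrun, ?_, holdsSetCover_of_tableState comp hcomp h2 h3 htab⟩
      simpa [eval_constrainedCostPoly] using ht
    · rw [isCover_coverSets_iff]
      -- With dedicated inputs each state is reached from its own input by the empty path.
      exact fun v => ⟨v, v, Finset.mem_univ v, by simp [dedicatedInputs], .refl⟩
    · simp only [SolvesUnconstrained, SolvesMinSetCover, hiff]
  · refine ⟨constrainedProgram, constrainedCostPoly, fun N L W Bbar hW => ?_⟩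
    obtain ⟨comp, hcomp⟩ := exists_enumeration W
    have hiff := isStructurallyControllable_selectColumns_iff hW Bbar comp
    refine ⟨_, comp, _, rfl, ?_, isCover_univ_iff hW Bbar comp, hiff, fun J => ?_⟩
    · obtain ⟨t, m, hrun, ht, h2, h3, htab⟩ := achieves_constrainedProgram_of_arrayOf
        (Bbar := Bbar) (m := constrainedInput W Bbar) hW rfl rfl (fun _ _ => rfl)
        (fun _ _ => rfl) fun _ _ => rfl
      refine ⟨t, m, hrun, ?_, holdsSetCover_of_tableState comp hcomp h2 h3 htab⟩
      rw [eval_constrainedCostPoly]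
      exact ht.trans (constrainedCost_le N L)
    · simp only [SolvesConstrained, SolvesMinSetCover, hiff]
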